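/- Let $G$ be a non-elementary hyperbolic group, that is, a group that is not virtually abelian and for which the word metric of some finite symmetric generating set is Gromov hyperbolic. Let $\mathcal D(G)$ be the set of all hyperbolic, left-invariant pseudometrics on $G$ for which the identity map of $G$ is a quasi-isometry to the word metric of some finite symmetric generating set, where a pseudometric $d$ is hyperbolic if there is $\delta\ge 0$ such that $(x|z)_w\ge\min\{(x|y)_w,(y|z)_w\}-\delta$ for all $x,y,z,w\in G$, with $(x|y)_w=\frac12\big(d(x,w)+d(y,w)-d(x,y)\big)$. Two pseudometrics $d,d'\in\mathcal D(G)$ are roughly similar if $|d-k\,d'|\le A$ on $G\times G$ for some constants $k,A>0$; let $\mathscr D(G)$, the space of metric structures on $G$, be the set of rough similarity classes $[d]$ of elements $d\in\mathcal D(G)$. For $\rho_1=[d_1]$ and $\rho_2=[d_2]$ in $\mathscr D(G)$ put $$\Lambda(\rho_1,\rho_2)=\inf\Big\{\lambda_1\lambda_2 : \lambda_1,\lambda_2>0,\ \exists A\ge 0\ \text{ such that }\ \tfrac1{\lambda_1}d_2-A\le d_1\le\lambda_2 d_2+A \text{ on } G\times G\Big\},$$ $$\Delta(\rho_1,\rho_2)=\log\Lambda(\rho_1,\rho_2),$$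 which does not depend on the choice of the representatives $d_1,d_2$. Then $\Delta$ is a metric on $\mathscr D(G)$, and the metric space $(\mathscr D(G),\Delta)$ is unbounded and contractible. -/

import Mathlib

noncomputable section

namespace HypMetric

/-- The Gromov product `(x|y)_w` with respect to a distance function `d`. -/
def gromovProd {X : Type*} (d : X → X → ℝ) (w x y : X) : ℝ :=
  (d x w + d y w - d x y) / 2

/-- Gromov hyperbolicity: the four point inequality with some constant `δ ≥ 0`. -/
def IsHyperbolic {X : Type*} (d : X → X → ℝ) : Prop :=
  ∃ δ : ℝ, 0 ≤ δ ∧ ∀ x y z w : X,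
    min (gromovProd d w x y) (gromovProd d w y z) - δ ≤ gromovProd d w x z

/-- Two distance functions on the same set are quasi-isometric if the identity map is a
quasi-isometry between them (the identity is onto, so coarse density of the image is automatic). -/
def AreQuasiIsometric {X : Type*} (d₁ d₂ : X → X → ℝ) : Prop :=
  ∃ l₁ l₂ ε : ℝ, 0 < l₁ ∧ 0 < l₂ ∧ 0 ≤ ε ∧
    ∀ x y : X, 1 / l₁ * d₁ x y - ε ≤ d₂ x y ∧ d₂ x y ≤ l₂ * d₁ x y + ε

/-- Two distance functions `d`, `d'` are roughly similar if `|d - k * d'| ≤ A` for some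
`k, A > 0`. -/
def AreRoughlySimilar {X : Type*} (d d' : X → X → ℝ) : Prop :=
  ∃ k A : ℝ, 0 < k ∧ 0 < A ∧ ∀ x y : X, |d x y - k * d' x y| ≤ A

/-- `S` is a finite symmetric generating set of the group `G`. -/
structure IsFiniteSymmGenSet {G : Type*} [Group G] (S : Set G) : Prop where
  finite : S.Finite
  symm : ∀ s ∈ S, s⁻¹ ∈ S
  generates : Subgroup.closure S = ⊤

/-- The word length `|g|_S`: the least `n` such that `g` is a product of `n` elements of `S`.
It is only used for symmetric generating sets, where such an `n` exists. -/
def wordLength {G : Type*} [Group G] (S : Set G) (g : G) : ℕ :=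
  sInf {n : ℕ | ∃ l : List G, l.length = n ∧ (∀ s ∈ l, s ∈ S) ∧ l.prod = g}

/-- The word metric `d_S(x, y) = |x⁻¹ y|_S`. -/
def wordDist {G : Type*} [Group G] (S : Set G) (x y : G) : ℝ :=
  (wordLength S (x⁻¹ * y) : ℝ)

/-- A group is hyperbolic if the word metric of some finite symmetric generating set is
hyperbolic. -/
def IsHyperbolicGroup (G : Type*) [Group G] : Prop :=
  ∃ S : Set G, IsFiniteSymmGenSet S ∧ IsHyperbolic (wordDist S)

/-- A group is virtually abelian if it has an abelian subgroup of finite index. -/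
def IsVirtuallyAbelian (G : Type*) [Group G] : Prop :=
  ∃ H : Subgroup G, H.FiniteIndex ∧ ∀ a ∈ H, ∀ b ∈ H, a * b = b * a

/-- The set of all hyperbolic left-invariant pseudometrics on `G` that are quasi-isometric to the
word metric of a finite symmetric generating set. -/
def hypPseudometrics (G : Type*) [Group G] : Set (PseudoMetric G ℝ) :=
  {d | IsHyperbolic d ∧ (∀ g x y : G, d (g * x) (g * y) = d x y) ∧
    ∃ S : Set G, IsFiniteSymmGenSet S ∧ AreQuasiIsometric d (wordDist S)}

theorem AreRoughlySimilar.refl {X : Type*} (d : X → X → ℝ) : AreRoughlySimilar d d :=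
  ⟨1, 1, one_pos, one_pos, fun x y => by simp⟩

theorem AreRoughlySimilar.symm {X : Type*} {d d' : X → X → ℝ} (h : AreRoughlySimilar d d') :
    AreRoughlySimilar d' d := by
  obtain ⟨k, A, hk, hA, h⟩ := h
  refine ⟨k⁻¹, k⁻¹ * A, inv_pos.2 hk, by positivity, fun x y => ?_⟩
  have e : d' x y - k⁻¹ * d x y = -(k⁻¹ * (d x y - k * d' x y)) := by
    field_simp
    ring
  rw [e, abs_neg, abs_mul, abs_of_pos (inv_pos.2 hk)]
  exact mul_le_mul_of_nonneg_left (h x y) (inv_pos.2 hk).le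

theorem AreRoughlySimilar.trans {X : Type*} {d d' d'' : X → X → ℝ} (h : AreRoughlySimilar d d')
    (h' : AreRoughlySimilar d' d'') : AreRoughlySimilar d d'' := by
  obtain ⟨k, A, hk, hA, h⟩ := h
  obtain ⟨m, B, hm, hB, h'⟩ := h'
  refine ⟨k * m, A + k * B, by positivity, by positivity, fun x y => ?_⟩
  have e : d x y - k * m * d'' x y = (d x y - k * d' x y) + k * (d' x y - m * d'' x y) := by ring
  rw [e]
  refine (abs_add_le _ _).trans (add_le_add (h x y) ?_)
  rw [abs_mul, abs_of_pos hk]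
  exact mul_le_mul_of_nonneg_left (h' x y) hk.le

/-- Rough similarity as an equivalence relation on `hypPseudometrics G`. -/
def roughSimilarity (G : Type*) [Group G] : Setoid (hypPseudometrics G) where
  r d d' := AreRoughlySimilar (d : PseudoMetric G ℝ) (d' : PseudoMetric G ℝ)
  iseqv := ⟨fun _ => AreRoughlySimilar.refl _, AreRoughlySimilar.symm, AreRoughlySimilar.trans⟩

/-- The space of metric structures on `G`. -/
def MetricStructures (G : Type*) [Group G] : Type _ :=
  Quotient (roughSimilarity G)

/-- The products `l₁ * l₂` of constants `l₁, l₂ > 0` such that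
`(1 / l₁) * d₂ - A ≤ d₁ ≤ l₂ * d₂ + A` for some `A ≥ 0`. -/
def distortionSet {X : Type*} (d₁ d₂ : X → X → ℝ) : Set ℝ :=
  {r | ∃ l₁ l₂ : ℝ, 0 < l₁ ∧ 0 < l₂ ∧ r = l₁ * l₂ ∧ ∃ A : ℝ, 0 ≤ A ∧
    ∀ x y : X, 1 / l₁ * d₂ x y - A ≤ d₁ x y ∧ d₁ x y ≤ l₂ * d₂ x y + A}

theorem distortionSet_subset {X : Type*} {d₁ d₁' d₂ d₂' : X → X → ℝ}
    (h₁ : AreRoughlySimilar d₁' d₁) (h₂ : AreRoughlySimilar d₂ d₂') :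
    distortionSet d₁ d₂ ⊆ distortionSet d₁' d₂' := by
  obtain ⟨k, B, hk, hB, h₁⟩ := h₁
  obtain ⟨m, C, hm, hC, h₂⟩ := h₂
  rintro r ⟨l₁, l₂, hl₁, hl₂, rfl, A, hA, h⟩
  refine ⟨l₁ / (k * m), k * l₂ * m, by positivity, by positivity, ?_,
    B + k * A + k / l₁ * C + k * l₂ * C, by positivity, fun x y => ?_⟩
  · field_simp
  · obtain ⟨a, b⟩ := h x y
    obtain ⟨p, q⟩ := abs_le.1 (h₁ x y)
    obtain ⟨u, v⟩ := abs_le.1 (h₂ x y)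
    have e : 1 / (l₁ / (k * m)) * d₂' x y = k / l₁ * (m * d₂' x y) := by
      field_simp
    have e' : k * (1 / l₁ * d₂ x y - A) = k / l₁ * d₂ x y - k * A := by
      field_simp
    have a' := mul_le_mul_of_nonneg_left a hk.le
    have b' := mul_le_mul_of_nonneg_left b hk.le
    have hkl : 0 < k / l₁ := by positivity
    have hkl' : 0 < k * l₂ := by positivity
    have u' := mul_le_mul_of_nonneg_left u hkl.le
    have v' := mul_le_mul_of_nonneg_left v hkl'.le
    have c₁ : 0 ≤ k / l₁ * C := by positivity
    have c₂ : 0 ≤ k * l₂ * C := by positivity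
    rw [e]
    rw [e'] at a'
    constructor <;> nlinarith

/-- The optimal multiplicative distortion `Λ` between two metric structures. -/
def Lam {G : Type*} [Group G] (ρ₁ ρ₂ : MetricStructures G) : ℝ :=
  Quotient.liftOn₂ ρ₁ ρ₂
    (fun d₁ d₂ => sInf (distortionSet (d₁ : PseudoMetric G ℝ) (d₂ : PseudoMetric G ℝ)))
    (fun _ _ _ _ h₁ h₂ => congrArg sInf (Set.Subset.antisymm
      (distortionSet_subset (AreRoughlySimilar.symm h₁) h₂)
      (distortionSet_subset h₁ (AreRoughlySimilar.symm h₂))))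

/-- The distance `Δ = log Λ` between two metric structures. -/
def Delta {G : Type*} [Group G] (ρ₁ ρ₂ : MetricStructures G) : ℝ :=
  Real.log (Lam ρ₁ ρ₂)

end HypMetric

end

/-!
# Metric structures on a non-elementary hyperbolic group

Fix a finite symmetric generating set whose word metric `s` is hyperbolic. Three facts carry the
proof.

*Gromov products are coarsely comparable.* A quasi-geodesic sequence in a hyperbolic pseudometric
space has, at each of its points, a bounded Gromov product with respect to its endpoints
(`exists_gromovProd_le_of_isQuasiGeodesic`); no geodesics are needed, since the two numbers
`(p|y)_x` and `(x|y)_p` serve as the coordinate of `p` along, and its distance to, a virtual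
geodesic from `x` to `y`. It follows that the pseudometrics under consideration are exactly the
left-invariant ones that are quasi-isometric to `s` and whose Gromov products are bounded wherever
those of `s` are (`mem_hypPseudometrics_iff`). This condition passes to positive combinations
(`weightedSum_mem`) and holds for all word metrics (`wordMetric_mem_hypPseudometrics`).

*Points can be moved into general position by bounded elements* (`exists_general_position`).
Otherwise an ultrafilter on the group would escape to infinity in a direction with a stabilizer of
finite index; on this stabilizer the Busemann function is a proper quasimorphism, so some infinite
cyclic or trivial subgroup has finite index and the group is virtually abelian. Two consequences
are that `d(1, g)` is, up to a bounded error, the stable length of some `g * v` with `v` of bounded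
length (`exists_le_stableLength_mul`), and that the growth is exponential
(`exists_two_pow_le_card`).

*Stable lengths determine the rough similarity class.* If `Λ = 1`, then the stable lengths are
proportional, so the pseudometrics are roughly similar; hence `Δ` is a metric.

For unboundedness, adjoin a power `aⁿ` to the generators: the stable length of `a` drops to at most
`1 / n`, so bounded distortion would make all lengths drop at this rate, although exponential growth
forbids this for a bounded number of generators (`exists_lt_Delta`). For contractibility, normalize
representatives by their stable length at a fixed element and move along straight lines to `s`
(`contractibleSpace_metricStructures`).
-/

noncomputable section

namespace HypMetric

/-! ### Gromov products in a pseudometric space -/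

/-- The four point inequality with the explicit constant `δ`. -/
def HyperbolicWith {X : Type*} (d : X → X → ℝ) (δ : ℝ) : Prop :=
  0 ≤ δ ∧ ∀ x y z w : X,
    min (gromovProd d w x y) (gromovProd d w y z) - δ ≤ gromovProd d w x z

section Gromov

variable {X : Type*} (d : PseudoMetric X ℝ)

theorem gromovProd_comm (w x y : X) : gromovProd d w x y = gromovProd d w y x := by
  simp only [gromovProd, d.symm x y]; ring

theorem gromovProd_nonneg (w x y : X) : 0 ≤ gromovProd d w x y := by
  have := d.triangle x w y
  rw [d.symm w y] at this
  simp only [gromovProd]; linarith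

theorem gromovProd_le (w x y : X) : gromovProd d w x y ≤ d w x := by
  have h1 := d.triangle y x w
  have h2 := d.symm x w
  have h3 := d.symm x y
  simp only [gromovProd]; linarith

theorem gromovProd_le' (w x y : X) : gromovProd d w x y ≤ d w y := by
  rw [gromovProd_comm]; exact gromovProd_le d w y x

theorem gromovProd_add (w x y : X) : gromovProd d w x y + gromovProd d x w y = d w x := by
  simp only [gromovProd, d.symm x w, d.symm w y, d.symm x y]; ring

theorem gromovProd_base_le (p q x y : X) :
    gromovProd d p x y ≤ gromovProd d q x y + d p q := by
  have h1 := d.triangle x q p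
  have h2 := d.triangle y q p
  have h3 := d.symm p q
  simp only [gromovProd]; linarith

theorem gromovProd_left_le (w p q y : X) :
    gromovProd d w p y ≤ gromovProd d w q y + d p q := by
  have h1 := d.triangle p q w
  have h2 := d.triangle q p y
  have h3 := d.symm p q
  simp only [gromovProd]; linarith

variable {d} {δ : ℝ}

theorem HyperbolicWith.four_point (hd : HyperbolicWith d δ) (x y z w : X) :
    d x z + d y w ≤ max (d x y + d z w) (d y z + d x w) + 2 * δ := by
  have h := hd.2 x y z w
  simp only [gromovProd] at h
  rcases min_cases ((d x w + d y w - d x y) / 2) ((d y w + d z w - d y z) / 2) with h' | h'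
  · have := le_max_left (d x y + d z w) (d y z + d x w); linarith
  · have := le_max_right (d x y + d z w) (d y z + d x w); linarith

theorem HyperbolicWith.min_le {d : X → X → ℝ} (hd : HyperbolicWith d δ) {x z w : X} {C : ℝ}
    (h : gromovProd d w x z ≤ C) (y : X) :
    gromovProd d w x y ≤ C + δ ∨ gromovProd d w y z ≤ C + δ := by
  have := hd.2 x y z w
  exact min_le_iff.1 (by linarith)

/-- Two points are close once their coordinates along, and distances to, a virtual geodesic from
`x` to `y` are controlled. -/
theorem HyperbolicWith.dist_le (hd : HyperbolicWith d δ) (x y p q : X) :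
    d p q ≤ |gromovProd d x p y - gromovProd d x q y| + gromovProd d p x y + gromovProd d q x y
      + 2 * δ := by
  have h := hd.four_point p x q y
  have a1 := le_abs_self (gromovProd d x p y - gromovProd d x q y)
  have a2 := neg_abs_le (gromovProd d x p y - gromovProd d x q y)
  simp only [gromovProd, d.symm p x, d.symm q x, d.symm y p, d.symm y q, d.symm y x] at *
  rcases max_cases (d x p + d q y) (d x q + d p y) with h' | h' <;> linarith

/-- Distances to a virtual geodesic from `x` to `y` add up as soon as the coordinates along it
differ by more than `δ`. -/
theorem HyperbolicWith.le_dist (hd : HyperbolicWith d δ) {x y p q : X}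
    (hpq : δ < gromovProd d x p y - gromovProd d x q y) :
    gromovProd d x p y - gromovProd d x q y + gromovProd d p x y + gromovProd d q x y - 2 * δ
      ≤ d p q := by
  have h := hd.four_point x q p y
  simp only [gromovProd, d.symm p x, d.symm q x, d.symm y p, d.symm y q, d.symm y x,
    d.symm q p] at *
  rcases max_cases (d x q + d p y) (d p q + d x y) with h' | h' <;> linarith [hd.1]

theorem HyperbolicWith.abs_le_of_dist (hd : HyperbolicWith d δ) {x y p q : X} {D : ℝ}
    (hp : D ≤ gromovProd d p x y) (hq : D ≤ gromovProd d q x y)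
    (hpq : d p q ≤ 2 * D - 2 * δ) :
    |gromovProd d x p y - gromovProd d x q y| ≤ δ := by
  have h0 := hd.1
  refine abs_le.2 ⟨?_, ?_⟩
  · by_contra! h
    have := hd.le_dist (x := x) (y := y) (p := q) (q := p) (by linarith)
    rw [d.symm q p] at this
    linarith
  · by_contra! h
    have := hd.le_dist (x := x) (y := y) (p := p) (q := q) (by linarith)
    linarith

end Gromov

/-! ### Stability of quasi-geodesic sequences -/

/-- The points `c 0, …, c n` form a quasi-geodesic of `d`: up to the constants `L` and `ε`,
distances are differences of indices. The values of `c` beyond `n` are irrelevant. -/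
structure IsQuasiGeodesic {X : Type*} (d : X → X → ℝ) (L ε : ℝ) (n : ℕ) (c : ℕ → X) : Prop where
  le : ∀ i j : ℕ, i ≤ j → j ≤ n → d (c i) (c j) ≤ L * ((j : ℝ) - i) + ε
  ge : ∀ i j : ℕ, i ≤ j → j ≤ n → (j : ℝ) - i ≤ L * d (c i) (c j) + ε

/-- Along a quasi-geodesic that stays far from a virtual geodesic joining `x` to `y`, the
coordinate along that virtual geodesic moves slowly: by at most `δ` in every `W` steps. -/
theorem HyperbolicWith.abs_gromovProd_le_of_far {X : Type*} {d : PseudoMetric X ℝ} {δ L ε D : ℝ}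
    (hd : HyperbolicWith d δ) (hL : 0 ≤ L) {n : ℕ} {c : ℕ → X} (hc : IsQuasiGeodesic d L ε n c)
    {W : ℕ} (hD : L * W + ε ≤ 2 * D - 2 * δ) (x y : X) {i j : ℕ} (hjn : j ≤ n)
    (hfar : ∀ m, i ≤ m → m ≤ j → D ≤ gromovProd d (c m) x y) (r : ℕ) :
    ∀ m, i ≤ m → m ≤ j → m ≤ i + r * W →
      |gromovProd d x (c m) y - gromovProd d x (c i) y| ≤ r * δ := by
  induction r with
  | zero =>
    intro m hm hmj hmr
    have : m = i := by omega
    simp [this]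
  | succ r ih =>
    intro m hm hmj hmr
    set m' := max i (m - W) with hm'
    have h1 := ih m' (by omega) (by omega) (by
      rw [Nat.succ_mul] at hmr; omega)
    have h2 : |gromovProd d x (c m) y - gromovProd d x (c m') y| ≤ δ := by
      rw [abs_sub_comm]
      refine hd.abs_le_of_dist (hfar m' (by omega) (by omega)) (hfar m hm hmj) ?_
      refine (hc.le m' m (by omega) (by omega)).trans (le_trans ?_ hD)
      have : (m : ℝ) - m' ≤ W := by
        have : m ≤ m' + W := by omega
        have : (m : ℝ) ≤ m' + W := by exact_mod_cast this
        linarith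
      nlinarith
    have e : gromovProd d x (c m) y - gromovProd d x (c i) y =
      (gromovProd d x (c m) y - gromovProd d x (c m') y) +
      (gromovProd d x (c m') y - gromovProd d x (c i) y) := by ring
    rw [e]
    refine (abs_add_le _ _).trans ?_
    push_cast
    linarith

/-- Stability of quasi-geodesics, without geodesics: every point of a quasi-geodesic sequence in a
hyperbolic space has bounded Gromov product with respect to the two endpoints. -/
theorem exists_gromovProd_le_of_isQuasiGeodesic (X : Type*) {δ L ε : ℝ} (hL : 0 < L)
    (hε : 0 ≤ ε) : ∃ C : ℝ, ∀ d : PseudoMetric X ℝ, HyperbolicWith d δ → ∀ (n : ℕ) (c : ℕ → X),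
      IsQuasiGeodesic d L ε n c → ∀ k ≤ n, gromovProd d (c k) (c 0) (c n) ≤ C := by
  -- `D` is so large that `W` steps at height more than `D` move the coordinate by at most `δ`, and
  -- `W` so large that this is less than half of the least speed `1 / L` of a quasi-geodesic; hence
  -- an excursion above height `D` has at most `N₀` steps
  obtain ⟨W, hW⟩ := exists_nat_gt (2 * L * |δ|)
  have hW0 : (0 : ℝ) < W := lt_of_le_of_lt (by positivity) hW
  set J := L + ε with hJ
  set D := |δ| + (L * W + ε) / 2 with hD
  set N₀ := 2 * (L * (3 * |δ| + 2 * D + 4 * J) + ε) with hN₀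
  have hD0 : 0 ≤ D := by positivity
  have hN0 : 0 ≤ N₀ := by positivity
  refine ⟨D + L * N₀ + ε, fun d hd n c hc k hk => ?_⟩
  have hδ : |δ| = δ := abs_of_nonneg hd.1
  rw [hδ] at hD hN₀ hW
  have hδ0 := hd.1
  by_cases hkD : gromovProd d (c k) (c 0) (c n) ≤ D
  · have : 0 ≤ L * N₀ := by positivity
    linarith
  push Not at hkD
  set h : ℕ → ℝ := fun m => gromovProd d (c m) (c 0) (c n) with hh
  -- the maximal excursion around `k` during which the sequence is at height more than `D`
  obtain ⟨i, hik, hi, hi'⟩ : ∃ i ≤ k, h i ≤ D ∧ ∀ m, i < m → m ≤ k → D < h m := by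
    classical
    have h0 : h 0 ≤ D := by simpa [hh, gromovProd, d.symm] using hD0
    refine ⟨Nat.findGreatest (fun m => h m ≤ D) k, Nat.findGreatest_le k,
      Nat.findGreatest_spec (P := fun m => h m ≤ D) (Nat.zero_le k) h0, fun m hm hmk => ?_⟩
    exact not_le.1 (Nat.findGreatest_is_greatest (P := fun m => h m ≤ D) hm hmk)
  obtain ⟨j, hkj, hjn, hj, hj'⟩ : ∃ j, k ≤ j ∧ j ≤ n ∧ h j ≤ D ∧ ∀ m, k ≤ m → m < j → D < h m := by
    classical
    have hn : ∃ m, k ≤ m ∧ h m ≤ D := ⟨n, hk, by simpa [hh, gromovProd, d.symm] using hD0⟩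
    refine ⟨Nat.find hn, (Nat.find_spec hn).1, Nat.find_min' hn ⟨hk, ?_⟩, (Nat.find_spec hn).2,
      fun m hm hmj => ?_⟩
    · simpa [hh, gromovProd, d.symm] using hD0
    · have := Nat.find_min hn hmj
      push Not at this
      exact this hm
  have hik' : i < k := lt_of_le_of_ne hik (by rintro rfl; exact absurd hi (not_le.2 hkD))
  have hkj' : k < j := lt_of_le_of_ne hkj (by rintro rfl; exact absurd hj (not_le.2 hkD))
  have step : ∀ m, m + 1 ≤ n → d (c m) (c (m + 1)) ≤ J := fun m hm => by
    have := hc.le m (m + 1) (by omega) hm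
    push_cast at this
    linarith
  have si := step i (by omega)
  have sj := step (j - 1) (by omega)
  rw [Nat.sub_add_cancel (by omega)] at sj
  have hi1 : h (i + 1) ≤ D + J := by
    have := gromovProd_base_le d (c (i + 1)) (c i) (c 0) (c n)
    rw [d.symm] at this
    simp only [hh] at hi ⊢; linarith
  have hj1 : h (j - 1) ≤ D + J := by
    have := gromovProd_base_le d (c (j - 1)) (c j) (c 0) (c n)
    simp only [hh] at hj ⊢; linarith
  have hNle : ((j - i : ℕ) : ℝ) ≤ N₀ := by
    set r := (j - i) / W + 1 with hr
    have hfar := hd.abs_gromovProd_le_of_far hL.le hc (W := W) (D := D) (by rw [hD]; linarith)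
      (c 0) (c n) (i := i + 1) (j := j - 1) (by omega)
      (fun m hm hm' => by
        rcases le_total m k with hmk | hmk
        · exact (hi' m (by omega) hmk).le
        · exact (hj' m hmk (by omega)).le) r (j - 1) (by omega) le_rfl
      (by
        have hWn : 0 < W := by exact_mod_cast hW0
        have := Nat.lt_div_mul_add (a := j - i) hWn
        rw [hr, Nat.succ_mul]; omega)
    have hrle : (r : ℝ) * δ ≤ ((j - i : ℕ) : ℝ) / (2 * L) + δ := by
      have : (((j - i) / W : ℕ) : ℝ) ≤ ((j - i : ℕ) : ℝ) / W := Nat.cast_div_le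
      have h2 : (((j - i) / W : ℕ) : ℝ) * δ ≤ ((j - i : ℕ) : ℝ) / W * δ :=
        mul_le_mul_of_nonneg_right this hδ0
      have h3 : ((j - i : ℕ) : ℝ) / W * δ ≤ ((j - i : ℕ) : ℝ) / (2 * L) := by
        rw [div_mul_eq_mul_div, div_le_div_iff₀ hW0 (by positivity)]
        have := mul_le_mul_of_nonneg_left hW.le (Nat.cast_nonneg (α := ℝ) (j - i))
        nlinarith
      rw [hr]; push_cast; linarith
    have hdist := hd.dist_le (c 0) (c n) (c (j - 1)) (c (i + 1))
    have t1 := d.triangle (c i) (c (i + 1)) (c j)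
    have t2 := d.triangle (c (i + 1)) (c (j - 1)) (c j)
    rw [d.symm (c (i + 1)) (c (j - 1))] at t2
    have hge := hc.ge i j (by omega) hjn
    rw [← Nat.cast_sub (by omega)] at hge
    simp only [hh] at hi1 hj1
    have hdij : d (c i) (c j) ≤ ((j - i : ℕ) : ℝ) / (2 * L) + (3 * δ + 2 * D + 4 * J) := by
      linarith
    have := mul_le_mul_of_nonneg_left hdij hL.le
    have e : L * (((j - i : ℕ) : ℝ) / (2 * L) + (3 * δ + 2 * D + 4 * J)) =
      ((j - i : ℕ) : ℝ) / 2 + L * (3 * δ + 2 * D + 4 * J) := by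
      field_simp
    rw [e] at this
    rw [hN₀]; linarith
  have hki := hc.le i k hik (by omega)
  have hb := gromovProd_base_le d (c k) (c i) (c 0) (c n)
  rw [d.symm] at hb
  have : L * ((k : ℝ) - i) ≤ L * N₀ := by
    refine mul_le_mul_of_nonneg_left (le_trans ?_ hNle) hL.le
    rw [← Nat.cast_sub hik]
    exact_mod_cast (by omega : k - i ≤ j - i)
  simp only [hh] at hi
  linarith

/-! ### Comparing Gromov products of quasi-isometric pseudometrics -/

/-- A symmetric form of `AreQuasiIsometric`, with one multiplicative constant for both bounds. -/
def Comparable {X : Type*} (d e : X → X → ℝ) : Prop :=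
  ∃ L ε : ℝ, 0 < L ∧ 0 ≤ ε ∧ ∀ x y, d x y ≤ L * e x y + ε ∧ e x y ≤ L * d x y + ε

/-- Any two points are joined by an isometrically embedded interval of integers. -/
def IsDiscreteGeodesic {X : Type*} (e : X → X → ℝ) : Prop :=
  ∀ x y : X, ∃ (n : ℕ) (c : ℕ → X), c 0 = x ∧ c n = y ∧
    ∀ i j : ℕ, i ≤ j → j ≤ n → e (c i) (c j) = (j : ℝ) - i

/-- Bounded Gromov products for `d` are bounded for `e`. In terms of a geodesic hyperbolic `d`:
points close to `d`-geodesics are close to being on `e`-geodesics. -/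
def ControlsProducts {X : Type*} (d e : X → X → ℝ) : Prop :=
  ∀ C : ℝ, ∃ C' : ℝ, ∀ w x y : X, gromovProd d w x y ≤ C → gromovProd e w x y ≤ C'

section

variable {X : Type*}

theorem Comparable.symm {d e : X → X → ℝ} (h : Comparable d e) : Comparable e d := by
  obtain ⟨L, ε, hL, hε, h⟩ := h
  exact ⟨L, ε, hL, hε, fun x y => ⟨(h x y).2, (h x y).1⟩⟩

theorem Comparable.trans {d e f : X → X → ℝ} (h : Comparable d e) (h' : Comparable e f) :
    Comparable d f := by
  obtain ⟨L, ε, hL, hε, h⟩ := h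
  obtain ⟨M, η, hM, hη, h'⟩ := h'
  refine ⟨L * M, L * η + ε + M * ε + η, by positivity, by positivity, fun x y => ?_⟩
  obtain ⟨a, b⟩ := h x y
  obtain ⟨a', b'⟩ := h' x y
  have p := mul_le_mul_of_nonneg_left a' hL.le
  have q := mul_le_mul_of_nonneg_left b hM.le
  have r : 0 ≤ L * η := by positivity
  have r' : 0 ≤ M * ε := by positivity
  constructor <;> nlinarith

theorem areQuasiIsometric_iff_comparable {d e : PseudoMetric X ℝ} :
    AreQuasiIsometric d e ↔ Comparable d e := by
  constructor
  · rintro ⟨l₁, l₂, ε, h₁, h₂, hε, h⟩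
    refine ⟨l₁ + l₂, l₁ * ε + ε, by positivity, by positivity, fun x y => ?_⟩
    obtain ⟨a, b⟩ := h x y
    have hd := d.nonneg x y
    have he := e.nonneg x y
    have a' := mul_le_mul_of_nonneg_left a h₁.le
    have e1 : l₁ * (1 / l₁ * d x y - ε) = d x y - l₁ * ε := by field_simp
    rw [e1] at a'
    have : 0 ≤ l₁ * ε := by positivity
    have := mul_nonneg h₂.le he
    have := mul_nonneg h₁.le hd
    constructor <;> nlinarith
  · rintro ⟨L, ε, hL, hε, h⟩
    refine ⟨L, L, ε + ε / L, hL, hL, by positivity, fun x y => ?_⟩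
    obtain ⟨a, b⟩ := h x y
    have : 0 ≤ ε / L := by positivity
    refine ⟨?_, by linarith⟩
    have : 1 / L * d x y ≤ 1 / L * (L * e x y + ε) := by gcongr
    have e1 : 1 / L * (L * e x y + ε) = e x y + ε / L := by field_simp
    linarith

theorem ControlsProducts.add {d e f : X → X → ℝ} (h : ControlsProducts d e)
    (h' : ControlsProducts d f) {a b : ℝ} (ha : 0 ≤ a) (hb : 0 ≤ b) :
    ControlsProducts d (fun x y => a * e x y + b * f x y) := by
  intro C
  obtain ⟨C₁, h₁⟩ := h C
  obtain ⟨C₂, h₂⟩ := h' C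
  refine ⟨a * C₁ + b * C₂, fun w x y hw => ?_⟩
  have := mul_le_mul_of_nonneg_left (h₁ w x y hw) ha
  have := mul_le_mul_of_nonneg_left (h₂ w x y hw) hb
  simp only [gromovProd] at *
  linarith

/-- A geodesic of `e` is a quasi-geodesic of any comparable pseudometric. -/
theorem isQuasiGeodesic_of_geodesic {d e : X → X → ℝ} {L ε : ℝ}
    (h : ∀ x y, d x y ≤ L * e x y + ε ∧ e x y ≤ L * d x y + ε) {n : ℕ} {c : ℕ → X}
    (hc : ∀ i j : ℕ, i ≤ j → j ≤ n → e (c i) (c j) = (j : ℝ) - i) :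
    IsQuasiGeodesic d L ε n c where
  le i j hij hj := by have := (h (c i) (c j)).1; rwa [hc i j hij hj] at this
  ge i j hij hj := by have := (h (c i) (c j)).2; rwa [hc i j hij hj] at this

/-- A real sequence with increments at most `J` comes within `J` of every intermediate value. -/
theorem exists_abs_sub_le_of_step {f : ℕ → ℝ} {n : ℕ} {t J : ℝ}
    (h0 : f 0 ≤ t) (hn : t ≤ f n) (hJ : ∀ i < n, |f (i + 1) - f i| ≤ J) (hJ0 : 0 ≤ J) :
    ∃ i ≤ n, |f i - t| ≤ J := by
  classical
  have hex : ∃ i, t ≤ f i := ⟨n, hn⟩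
  have hle : Nat.find hex ≤ n := Nat.find_min' hex hn
  have hsp := Nat.find_spec hex
  refine ⟨Nat.find hex, hle, ?_⟩
  rcases Nat.eq_zero_or_pos (Nat.find hex) with h | h
  · rw [h] at hsp ⊢
    have : f 0 = t := le_antisymm h0 hsp
    simpa [this] using hJ0
  · have hm := Nat.find_min hex (Nat.sub_one_lt_of_lt h)
    have := hJ (Nat.find hex - 1) (by omega)
    rw [Nat.sub_add_cancel h] at this
    push Not at hm
    rw [abs_of_nonneg (by linarith)]
    linarith [le_abs_self (f (Nat.find hex) - f (Nat.find hex - 1))]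

/-- A point with bounded `s`-Gromov product with respect to `x` and `y` is close to every geodesic
from `x` to `y` of a comparable pseudometric. -/
theorem HyperbolicWith.exists_dist_le {s e : PseudoMetric X ℝ} {δ : ℝ} (hs : HyperbolicWith s δ)
    (hse : Comparable s e) (C : ℝ) :
    ∃ C' : ℝ, ∀ (w x y : X) (n : ℕ) (c : ℕ → X), c 0 = x → c n = y →
      (∀ i j : ℕ, i ≤ j → j ≤ n → e (c i) (c j) = (j : ℝ) - i) →
      gromovProd s w x y ≤ C → ∃ i ≤ n, s w (c i) ≤ C' := by
  obtain ⟨L, ε, hL, hε, h⟩ := hse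
  obtain ⟨M, hM⟩ := exists_gromovProd_le_of_isQuasiGeodesic X (δ := δ) hL hε
  refine ⟨(L + ε) + C + M + 2 * δ, fun w x y n c h0 hn hc hw => ?_⟩
  have hq := isQuasiGeodesic_of_geodesic h hc
  have hstep : ∀ i < n, |gromovProd s x (c (i + 1)) y - gromovProd s x (c i) y| ≤ L + ε := by
    intro i hi
    have h1 := hq.le i (i + 1) (by omega) hi
    push_cast at h1
    have h2 := gromovProd_left_le s x (c (i + 1)) (c i) y
    have h3 := gromovProd_left_le s x (c i) (c (i + 1)) y
    rw [s.symm] at h2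
    exact abs_le.2 ⟨by linarith, by linarith⟩
  obtain ⟨i, hi, hit⟩ := exists_abs_sub_le_of_step (f := fun i => gromovProd s x (c i) y)
    (t := gromovProd s x w y) (n := n) (J := L + ε)
    (by
      have : gromovProd s x (c 0) y = 0 := by simp [h0, gromovProd, s.symm]
      simp only [this]; exact gromovProd_nonneg s x w y)
    (by
      have : gromovProd s x (c n) y = s x y := by simp [hn, gromovProd, s.symm]
      simp only [this]; exact gromovProd_le' s x w y)
    hstep (by positivity)
  refine ⟨i, hi, ?_⟩
  have h1 := hs.dist_le x y w (c i)
  have h2 := hM s hs n c hq i hi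
  rw [h0, hn] at h2
  rw [abs_sub_comm] at h1
  linarith

/-- Geodesic pseudometrics comparable to a hyperbolic pseudometric have controlled products. -/
theorem HyperbolicWith.controlsProducts_of_geodesic {s e : PseudoMetric X ℝ} {δ : ℝ}
    (hs : HyperbolicWith s δ) (hse : Comparable s e) (he : IsDiscreteGeodesic e) :
    ControlsProducts s e := by
  intro C
  obtain ⟨C', hC'⟩ := hs.exists_dist_le hse C
  obtain ⟨L, ε, hL, hε, h⟩ := hse
  refine ⟨L * C' + ε, fun w x y hw => ?_⟩
  obtain ⟨n, c, h0, hn, hc⟩ := he x y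
  obtain ⟨i, hi, hwi⟩ := hC' w x y n c h0 hn hc hw
  have hzero : gromovProd e (c i) x y = 0 := by
    have h1 := hc 0 i (Nat.zero_le i) hi
    have h2 := hc i n hi le_rfl
    have h3 := hc 0 n (Nat.zero_le n) le_rfl
    rw [h0] at h1 h3
    rw [hn] at h2 h3
    simp only [gromovProd, h1, h3, e.symm y (c i), h2]
    simp
  have h1 := gromovProd_base_le e w (c i) x y
  have h2 := (h w (c i)).2
  have := mul_le_mul_of_nonneg_left hwi hL.le
  linarith

/-- Hyperbolic pseudometrics comparable to a geodesic hyperbolic pseudometric have controlled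
products. -/
theorem HyperbolicWith.controlsProducts_of_hyperbolic {s d : PseudoMetric X ℝ} {δ δ' : ℝ}
    (hs : HyperbolicWith s δ) (hgeo : IsDiscreteGeodesic s) (hd : HyperbolicWith d δ')
    (hds : Comparable d s) : ControlsProducts s d := by
  intro C
  have hss : Comparable s s := ⟨1, 0, one_pos, le_rfl, fun x y => by simp⟩
  obtain ⟨C', hC'⟩ := hs.exists_dist_le hss C
  obtain ⟨L, ε, hL, hε, h⟩ := hds
  obtain ⟨M, hM⟩ := exists_gromovProd_le_of_isQuasiGeodesic X (δ := δ') hL hε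
  refine ⟨M + (L * C' + ε), fun w x y hw => ?_⟩
  obtain ⟨n, c, h0, hn, hc⟩ := hgeo x y
  obtain ⟨i, hi, hwi⟩ := hC' w x y n c h0 hn hc hw
  have h1 := hM d hd n c (isQuasiGeodesic_of_geodesic h hc) i hi
  rw [h0, hn] at h1
  have h2 := gromovProd_base_le d w (c i) x y
  have h3 := (h w (c i)).1
  have := mul_le_mul_of_nonneg_left hwi hL.le
  linarith

/-- Triangles in a geodesic hyperbolic space have centers. -/
theorem HyperbolicWith.exists_center {s : PseudoMetric X ℝ} {δ : ℝ} (hs : HyperbolicWith s δ)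
    (hgeo : IsDiscreteGeodesic s) (x y z : X) :
    ∃ q, gromovProd s q x y ≤ δ + 1 ∧ gromovProd s q y z ≤ δ + 1 ∧
      gromovProd s q x z ≤ δ + 1 := by
  classical
  have hδ := hs.1
  obtain ⟨n, c, h0, hn, hc⟩ := hgeo x y
  have hzero : ∀ i ≤ n, gromovProd s (c i) x y = 0 := by
    intro i hi
    have h1 := hc 0 i (Nat.zero_le i) hi
    have h2 := hc i n hi le_rfl
    have h3 := hc 0 n (Nat.zero_le n) le_rfl
    rw [h0] at h1 h3
    rw [hn] at h2 h3
    simp only [gromovProd, h1, h3, s.symm y (c i), h2]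
    simp
  -- the last point of the geodesic from `x` to `y` on the side of `x`
  set i := Nat.findGreatest (fun m => gromovProd s (c m) x z ≤ δ) n with hi
  have hin : i ≤ n := Nat.findGreatest_le n
  have hspec : gromovProd s (c i) x z ≤ δ :=
    Nat.findGreatest_spec (P := fun m => gromovProd s (c m) x z ≤ δ) (Nat.zero_le n)
      (by simpa [h0, gromovProd, s.symm] using hδ)
  refine ⟨c i, by rw [hzero i hin]; linarith, ?_, by linarith⟩
  rcases hin.eq_or_lt with hin' | hin'
  · have : gromovProd s (c i) y z = 0 := by rw [hin', hn]; simp [gromovProd, s.symm]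
    linarith
  · have hgt : δ < gromovProd s (c (i + 1)) x z := not_le.1
      (Nat.findGreatest_is_greatest (P := fun m => gromovProd s (c m) x z ≤ δ)
        (by omega : Nat.findGreatest (fun m => gromovProd s (c m) x z ≤ δ) n < i + 1) hin')
    have hlt : gromovProd s (c (i + 1)) z y ≤ 0 + δ :=
      (hs.min_le (hzero (i + 1) hin').le z).resolve_left (by linarith)
    have h1 := gromovProd_base_le s (c i) (c (i + 1)) z y
    have h2 := hc i (i + 1) (by omega) hin'
    push_cast at h2
    rw [gromovProd_comm]
    linarith

/-- A pseudometric whose products are controlled by a geodesic hyperbolic pseudometric is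
hyperbolic: for any four points, some point of the underlying tree-like picture has bounded
products with respect to two complementary pairs, which gives the four point inequality. -/
theorem HyperbolicWith.isHyperbolic_of_controlsProducts {s e : PseudoMetric X ℝ} {δ : ℝ}
    (hs : HyperbolicWith s δ) (hgeo : IsDiscreteGeodesic s) (he : ControlsProducts s e) :
    IsHyperbolic e := by
  obtain ⟨C, hC⟩ := he (δ + 1 + δ)
  have hδ := hs.1
  refine ⟨2 * |C|, by positivity, fun x y z w => ?_⟩
  -- `q` is a center of `x`, `y`, `z`; the position of `w` decides between the two cases
  have key : ∃ q, (gromovProd s q x y ≤ δ + 1 + δ ∧ gromovProd s q z w ≤ δ + 1 + δ) ∨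
      (gromovProd s q y z ≤ δ + 1 + δ ∧ gromovProd s q x w ≤ δ + 1 + δ) := by
    obtain ⟨q, h1, h2, h3⟩ := hs.exists_center hgeo x y z
    refine ⟨q, ?_⟩
    rcases hs.min_le h3 w with h | h
    · exact Or.inr ⟨by linarith, h⟩
    · exact Or.inl ⟨by linarith, by rw [gromovProd_comm]; exact h⟩
  obtain ⟨q, ⟨h1, h2⟩ | ⟨h1, h2⟩⟩ := key
  all_goals
    have h1' := (hC _ _ _ h1).trans (le_abs_self C)
    have h2' := (hC _ _ _ h2).trans (le_abs_self C)
    have t1 := e.triangle x q z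
    have t2 := e.triangle y q w
    rw [sub_le_iff_le_add]
    simp only [gromovProd, e.symm z q, e.symm w q, e.symm x q, e.symm y q] at *
  · exact (min_le_left _ _).trans (by linarith)
  · exact (min_le_right _ _).trans (by linarith)

end

/-! ### Word metrics -/

section Word

open scoped Pointwise

variable {G : Type*} [Group G] {S : Set G}

theorem IsFiniteSymmGenSet.exists_list (hS : IsFiniteSymmGenSet S) (g : G) :
    ∃ l : List G, (∀ s ∈ l, s ∈ S) ∧ l.prod = g := by
  have hg : g ∈ (Subgroup.closure S).toSubmonoid := by rw [hS.generates]; trivial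
  rw [Subgroup.closure_toSubmonoid] at hg
  obtain ⟨l, hl, hg⟩ := Submonoid.exists_list_of_mem_closure hg
  refine ⟨l, fun s hs => ?_, hg⟩
  rcases hl s hs with h | h
  · exact h
  · simpa using hS.symm _ h

theorem wordLength_prod_le {l : List G} (hl : ∀ s ∈ l, s ∈ S) : wordLength S l.prod ≤ l.length :=
  Nat.sInf_le ⟨l, rfl, hl, rfl⟩

theorem IsFiniteSymmGenSet.exists_minimal_list (hS : IsFiniteSymmGenSet S) (g : G) :
    ∃ l : List G, l.length = wordLength S g ∧ (∀ s ∈ l, s ∈ S) ∧ l.prod = g := by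
  obtain ⟨l, hl, hg⟩ := hS.exists_list g
  exact Nat.sInf_mem (s := {n : ℕ | ∃ l : List G, l.length = n ∧ (∀ s ∈ l, s ∈ S) ∧ l.prod = g})
    ⟨l.length, l, rfl, hl, hg⟩

theorem wordLength_one : wordLength S (1 : G) = 0 :=
  Nat.le_zero.1 (by simpa using wordLength_prod_le (S := S) (l := []) (by simp))

theorem IsFiniteSymmGenSet.wordLength_mul_le (hS : IsFiniteSymmGenSet S) (g h : G) :
    wordLength S (g * h) ≤ wordLength S g + wordLength S h := by
  obtain ⟨l, hl, hlS, rfl⟩ := hS.exists_minimal_list g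
  obtain ⟨m, hm, hmS, rfl⟩ := hS.exists_minimal_list h
  rw [← hl, ← hm, ← List.prod_append, ← List.length_append]
  exact wordLength_prod_le fun s hs => (List.mem_append.1 hs).elim (hlS s) (hmS s)

theorem IsFiniteSymmGenSet.wordLength_inv_le (hS : IsFiniteSymmGenSet S) (g : G) :
    wordLength S g⁻¹ ≤ wordLength S g := by
  obtain ⟨l, hl, hlS, rfl⟩ := hS.exists_minimal_list g
  rw [← hl, List.prod_inv_reverse]
  refine (wordLength_prod_le fun s hs => ?_).trans (by simp)
  simp only [List.mem_reverse, List.mem_map] at hs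
  obtain ⟨a, ha, rfl⟩ := hs
  exact hS.symm _ (hlS a ha)

theorem wordDist_mul_left (g x y : G) : wordDist S (g * x) (g * y) = wordDist S x y := by
  simp only [wordDist]
  congr 2
  group

/-- The word metric as a bundled pseudometric. -/
def wordMetric (hS : IsFiniteSymmGenSet S) : PseudoMetric G ℝ where
  toFun := wordDist S
  refl' x := by simp [wordDist, wordLength_one]
  symm' x y := by
    have h1 := hS.wordLength_inv_le (x⁻¹ * y)
    have h2 := hS.wordLength_inv_le (y⁻¹ * x)
    simp only [mul_inv_rev, inv_inv] at h1 h2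
    simp only [wordDist]
    exact_mod_cast le_antisymm h2 h1
  triangle' x y z := by
    have h := hS.wordLength_mul_le (x⁻¹ * y) (y⁻¹ * z)
    rw [show x⁻¹ * y * (y⁻¹ * z) = x⁻¹ * z by group] at h
    simp only [wordDist]
    exact_mod_cast h

theorem wordMetric_mul_left (hS : IsFiniteSymmGenSet S) (g x y : G) :
    wordMetric hS (g * x) (g * y) = wordMetric hS x y :=
  wordDist_mul_left g x y

theorem wordMetric_one (hS : IsFiniteSymmGenSet S) (g : G) :
    wordMetric hS 1 g = wordLength S g := by
  change wordDist S 1 g = _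
  simp [wordDist]

theorem isDiscreteGeodesic_wordMetric (hS : IsFiniteSymmGenSet S) :
    IsDiscreteGeodesic (wordMetric hS) := by
  intro x y
  obtain ⟨l, hl, hlS, hg⟩ := hS.exists_minimal_list (x⁻¹ * y)
  have hle : ∀ i j : ℕ, i ≤ j → j ≤ l.length →
      wordMetric hS (x * (l.take i).prod) (x * (l.take j).prod) ≤ (j : ℝ) - i := by
    intro i j hij hj
    rw [wordMetric_mul_left]
    change ((wordLength S _ : ℕ) : ℝ) ≤ _
    have e : (l.take i).prod⁻¹ * (l.take j).prod = ((l.take j).drop i).prod := by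
      rw [inv_mul_eq_iff_eq_mul, ← List.prod_take_mul_prod_drop (l.take j) i, List.take_take,
        min_eq_left hij]
    rw [e, ← Nat.cast_sub hij]
    have := wordLength_prod_le (S := S) (l := (l.take j).drop i)
      (fun s hs => hlS s (List.mem_of_mem_take (List.mem_of_mem_drop hs)))
    refine Nat.cast_le.2 (this.trans ?_)
    simp only [List.length_drop, List.length_take]
    omega
  refine ⟨l.length, fun i => x * (l.take i).prod, by simp, by simp [hg], fun i j hij hj => ?_⟩
  refine le_antisymm (hle i j hij hj) ?_
  have h1 := hle 0 i (Nat.zero_le i) (hij.trans hj)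
  have h2 := hle j l.length hj le_rfl
  have t1 := (wordMetric hS).triangle (x * (l.take 0).prod) (x * (l.take i).prod)
    (x * (l.take l.length).prod)
  have t2 := (wordMetric hS).triangle (x * (l.take i).prod) (x * (l.take j).prod)
    (x * (l.take l.length).prod)
  have h3 : wordMetric hS (x * (l.take 0).prod) (x * (l.take l.length).prod) = l.length := by
    rw [wordMetric_mul_left]
    change ((wordLength S _ : ℕ) : ℝ) = _
    rw [List.take_length, hg, List.take_zero, List.prod_nil, inv_one, one_mul, hl]
  push_cast at h1
  linarith

/-- Balls of a word metric are contained in powers of a finite set. -/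
theorem IsFiniteSymmGenSet.exists_finset_pow [DecidableEq G] (hS : IsFiniteSymmGenSet S) :
    ∃ T : Finset G, T.card ≤ S.ncard + 1 ∧ 1 ≤ T.card ∧
      ∀ (n : ℕ) (g : G), wordLength S g ≤ n → g ∈ T ^ n := by
  classical
  refine ⟨insert 1 hS.finite.toFinset, ?_, Finset.card_pos.2 ⟨1, by simp⟩, fun n g hg => ?_⟩
  · rw [Set.ncard_eq_toFinset_card S hS.finite]
    exact Finset.card_insert_le _ _
  · obtain ⟨l, hl, hlS, rfl⟩ := hS.exists_minimal_list g
    rw [← hl] at hg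
    refine Finset.pow_subset_pow_right (by simp) hg ?_
    clear hl hg
    induction l with
    | nil => simp
    | cons a l ih =>
      rw [List.prod_cons, List.length_cons, pow_succ']
      refine Finset.mul_mem_mul ?_ (ih fun s hs => hlS s (List.mem_cons_of_mem _ hs))
      simp [hlS a]

theorem finite_setOf_wordMetric_le (hS : IsFiniteSymmGenSet S) (r : ℝ) :
    {g : G | wordMetric hS 1 g ≤ r}.Finite := by
  classical
  obtain ⟨T, -, -, hT⟩ := hS.exists_finset_pow
  refine (T ^ ⌊r⌋₊).finite_toSet.subset fun g hg => hT _ g ?_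
  have hg' : wordMetric hS 1 g ≤ r := hg
  rw [wordMetric_one] at hg'
  exact Nat.le_floor hg'

/-- A left-invariant pseudometric grows at most linearly with respect to a word metric. -/
theorem exists_le_mul_wordMetric (hS : IsFiniteSymmGenSet S) (d : PseudoMetric G ℝ)
    (hd : ∀ g x y : G, d (g * x) (g * y) = d x y) :
    ∃ L : ℝ, 0 < L ∧ ∀ x y, d x y ≤ L * wordMetric hS x y := by
  obtain ⟨L, hL⟩ := (hS.finite.image fun s => d 1 s).bddAbove
  have hlist : ∀ l : List G, (∀ s ∈ l, s ∈ S) → d 1 l.prod ≤ (|L| + 1) * l.length := by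
    intro l
    induction l with
    | nil => intro; simp
    | cons a l ih =>
      intro hl
      have h1 := ih fun s hs => hl s (List.mem_cons_of_mem _ hs)
      have h2 : d 1 a ≤ L := hL ⟨a, hl a (by simp), rfl⟩
      have h3 := d.triangle 1 a (a * l.prod)
      have h4 : d a (a * l.prod) = d 1 l.prod := by simpa using hd a 1 l.prod
      have := le_abs_self L
      rw [List.prod_cons, List.length_cons]
      push_cast
      linarith
  refine ⟨|L| + 1, by positivity, fun x y => ?_⟩
  obtain ⟨l, hl, hlS, hg⟩ := hS.exists_minimal_list (x⁻¹ * y)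
  have h1 := hlist l hlS
  rw [hl, hg] at h1
  have h2 : d x y = d 1 (x⁻¹ * y) := by simpa using hd x 1 (x⁻¹ * y)
  rw [h2]
  exact h1

theorem comparable_wordMetric {S' : Set G} (hS : IsFiniteSymmGenSet S)
    (hS' : IsFiniteSymmGenSet S') : Comparable (wordMetric hS) (wordMetric hS') := by
  obtain ⟨L, hL, h⟩ := exists_le_mul_wordMetric hS' (wordMetric hS) (wordMetric_mul_left hS)
  obtain ⟨M, hM, h'⟩ := exists_le_mul_wordMetric hS (wordMetric hS') (wordMetric_mul_left hS')
  refine ⟨L + M, 0, by positivity, le_rfl, fun x y => ?_⟩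
  have h1 := h x y
  have h2 := h' x y
  have h3 := mul_nonneg hM.le ((wordMetric hS').nonneg x y)
  have h4 := mul_nonneg hL.le ((wordMetric hS).nonneg x y)
  constructor <;> linarith

/-- The hyperbolic pseudometrics of a hyperbolic group are exactly the left-invariant pseudometrics
that are comparable to a hyperbolic word metric and whose products it controls. -/
theorem mem_hypPseudometrics_iff {hS : IsFiniteSymmGenSet S} {δ : ℝ}
    (hδ : HyperbolicWith (wordMetric hS) δ) (d : PseudoMetric G ℝ) :
    d ∈ hypPseudometrics G ↔ (∀ g x y : G, d (g * x) (g * y) = d x y) ∧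
      Comparable d (wordMetric hS) ∧ ControlsProducts (wordMetric hS) d := by
  constructor
  · rintro ⟨⟨δ', hδ'⟩, hinv, S', hS', hq⟩
    have hc : Comparable d (wordMetric hS) :=
      (areQuasiIsometric_iff_comparable (e := wordMetric hS').1 hq).trans
        (comparable_wordMetric hS' hS)
    exact ⟨hinv, hc, hδ.controlsProducts_of_hyperbolic (isDiscreteGeodesic_wordMetric hS) hδ' hc⟩
  · rintro ⟨hinv, hc, hP⟩
    exact ⟨hδ.isHyperbolic_of_controlsProducts (isDiscreteGeodesic_wordMetric hS) hP, hinv, S, hS,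
      areQuasiIsometric_iff_comparable (e := wordMetric hS).2 hc⟩

theorem wordMetric_mem_hypPseudometrics {S' : Set G} {hS : IsFiniteSymmGenSet S} {δ : ℝ}
    (hδ : HyperbolicWith (wordMetric hS) δ) (hS' : IsFiniteSymmGenSet S') :
    wordMetric hS' ∈ hypPseudometrics G :=
  (mem_hypPseudometrics_iff hδ _).2 ⟨wordMetric_mul_left hS', comparable_wordMetric hS' hS,
    hδ.controlsProducts_of_geodesic (comparable_wordMetric hS hS')
      (isDiscreteGeodesic_wordMetric hS')⟩

end Word

/-! ### Stabilizers of directions at infinity -/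

theorem HyperbolicWith.abs_gromovProd_sub_le {X : Type*} {d : PseudoMetric X ℝ} {δ : ℝ}
    (hd : HyperbolicWith d δ) {w v y y' : X} (h : d w v ≤ gromovProd d w y y') :
    |gromovProd d w v y - gromovProd d w v y'| ≤ δ := by
  have h1 := hd.2 v y y' w
  have h2 := hd.2 v y' y w
  rw [gromovProd_comm d w y' y] at h2
  rw [min_eq_left ((gromovProd_le d w v y).trans h)] at h1
  rw [min_eq_left ((gromovProd_le d w v y').trans h)] at h2
  exact abs_le.2 ⟨by linarith, by linarith⟩

section LeftInvariant

variable {G : Type*} [Group G] {d : PseudoMetric G ℝ}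

theorem gromovProd_mul_left (hinv : ∀ g x y : G, d (g * x) (g * y) = d x y) (g w x y : G) :
    gromovProd d (g * w) (g * x) (g * y) = gromovProd d w x y := by
  simp only [gromovProd, hinv]

theorem dist_one_inv (hinv : ∀ g x y : G, d (g * x) (g * y) = d x y) (g : G) :
    d 1 g⁻¹ = d 1 g := by
  have := hinv g 1 g⁻¹
  rw [mul_one, mul_inv_cancel] at this
  rw [← this, d.symm]

theorem gromovProd_one_mul_left_le (hinv : ∀ g x y : G, d (g * x) (g * y) = d x y) (g x y : G) :
    gromovProd d 1 (g * x) (g * y) ≤ gromovProd d 1 x y + d 1 g := by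
  have h := gromovProd_base_le d 1 g (g * x) (g * y)
  have h' := gromovProd_mul_left hinv g 1 x y
  rw [mul_one] at h'
  linarith

end LeftInvariant

/-- If the increments `β (t ^ (n + 1) * g) - β (t ^ n * g)` are bounded above and bounded below by
a positive constant, then `β` is bounded somewhere on `{t ^ n * g}`. -/
theorem exists_abs_zpow_mul_le {G : Type*} [Group G] {β : G → ℝ} {t : G} {D : ℝ} (hD : 0 ≤ D)
    (hq : ∀ v, |β (t * v) - β t - β v| ≤ D) (ht : D + 1 ≤ β t) (g : G) :
    ∃ n : ℤ, |β (t ^ n * g)| ≤ β t + D := by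
  have aux : ∀ f : ℕ → ℝ, f 0 ≤ 0 → (∀ n, 1 ≤ f (n + 1) - f n ∧ f (n + 1) - f n ≤ β t + D) →
      ∃ n, |f n| ≤ β t + D := by
    intro f h0 hf
    have hlin : ∀ n : ℕ, f 0 + n ≤ f n := by
      intro n
      induction n with
      | zero => simp
      | succ n ih => have := (hf n).1; push_cast; linarith
    obtain ⟨n, hn⟩ := exists_nat_ge (-f 0)
    obtain ⟨i, -, hi⟩ := exists_abs_sub_le_of_step (f := f) (n := n) (t := 0) (J := β t + D) h0
      (by have := hlin n; linarith)
      (fun i _ => abs_le.2 ⟨by linarith [(hf i).1], (hf i).2⟩) (by linarith)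
    exact ⟨i, by simpa using hi⟩
  rcases le_total (β g) 0 with hg | hg
  · obtain ⟨n, hn⟩ := aux (fun n => β (t ^ n * g)) (by simpa using hg) (fun n => by
      have h := abs_le.1 (hq (t ^ n * g))
      rw [← mul_assoc, ← pow_succ'] at h
      constructor <;> linarith)
    exact ⟨n, by simpa using hn⟩
  · obtain ⟨n, hn⟩ := aux (fun n => -β (t⁻¹ ^ n * g)) (by simpa using hg) (fun n => by
      have h := abs_le.1 (hq (t⁻¹ ^ (n + 1) * g))
      rw [← mul_assoc, pow_succ' t⁻¹ n, ← mul_assoc, mul_inv_cancel, one_mul] at h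
      simp only [pow_succ' t⁻¹ n]
      constructor <;> linarith)
    exact ⟨-n, by simpa using hn⟩

section Direction

variable {G : Type*} [Group G] {S : Set G} {hS : IsFiniteSymmGenSet S} {δ : ℝ}

/-- The stabilizer of the direction in which an ultrafilter escapes to infinity: the elements that
move its points to points with arbitrarily large Gromov product with the original ones. -/
def directionStabilizer (hδ : HyperbolicWith (wordMetric hS) δ) (𝒰 : Ultrafilter G)
    (h𝒰 : ∀ R : ℝ, ∀ᶠ y in 𝒰, R < wordMetric hS 1 y) : Subgroup G where
  carrier := {u | ∀ R : ℝ, ∀ᶠ y in 𝒰, R < gromovProd (wordMetric hS) 1 y (u * y)}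
  one_mem' R := by
    filter_upwards [h𝒰 R] with y hy
    simpa [gromovProd, (wordMetric hS).symm y 1] using hy
  mul_mem' := by
    intro u v hu hv R
    filter_upwards [hu (R + δ), hv (R + δ + wordMetric hS 1 u⁻¹)] with y h1 h2
    have h3 := hδ.2 y (u * y) (u * v * y) 1
    have h4 := gromovProd_one_mul_left_le (wordMetric_mul_left hS) u⁻¹ (u * y) (u * v * y)
    rw [inv_mul_cancel_left, mul_assoc, inv_mul_cancel_left, ← mul_assoc] at h4
    have : R + δ < min (gromovProd (wordMetric hS) 1 y (u * y))
      (gromovProd (wordMetric hS) 1 (u * y) (u * v * y)) := lt_min h1 (by linarith)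
    linarith
  inv_mem' := by
    intro u hu R
    filter_upwards [hu (R + wordMetric hS 1 u)] with y hy
    have h := gromovProd_one_mul_left_le (wordMetric_mul_left hS) u y (u⁻¹ * y)
    rw [mul_inv_cancel_left, gromovProd_comm] at h
    linarith

variable {𝒰 : Ultrafilter G} {h𝒰 : ∀ R : ℝ, ∀ᶠ y in 𝒰, R < wordMetric hS 1 y}

/-- A Busemann function along the ultrafilter, up to an error of `1`. -/
theorem exists_busemann (hS : IsFiniteSymmGenSet S) (𝒰 : Ultrafilter G) :
    ∃ β : G → ℝ, ∀ u, ∀ᶠ y in 𝒰, |wordMetric hS u y - wordMetric hS 1 y - β u| ≤ 1 := by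
  have h : ∀ u : G, ∃ b : ℝ, ∀ᶠ y in 𝒰, |wordMetric hS u y - wordMetric hS 1 y - b| ≤ 1 := by
    intro u
    obtain ⟨b, -, hb⟩ := (isCompact_Icc (a := -wordMetric hS 1 u)
      (b := wordMetric hS 1 u)).ultrafilter_le_nhds
      (𝒰.map fun y => wordMetric hS u y - wordMetric hS 1 y) (by
        refine Filter.le_principal_iff.2 (Filter.mem_map.2 (Filter.univ_mem' fun y => ?_))
        have h1 := (wordMetric hS).triangle u 1 y
        have h2 := (wordMetric hS).triangle 1 u y
        rw [(wordMetric hS).symm u 1] at h1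
        exact ⟨by linarith, by linarith⟩)
    refine ⟨b, ?_⟩
    have := hb (Metric.closedBall_mem_nhds b one_pos)
    filter_upwards [this] with y hy
    rwa [← Real.dist_eq]
  choose β hβ using h
  exact ⟨β, hβ⟩

/-- The Busemann function is a quasimorphism on the stabilizer of the direction. -/
theorem abs_busemann_mul_le (hδ : HyperbolicWith (wordMetric hS) δ) {β : G → ℝ}
    (hβ : ∀ u, ∀ᶠ y in 𝒰, |wordMetric hS u y - wordMetric hS 1 y - β u| ≤ 1) {u : G}
    (hu : u ∈ directionStabilizer hδ 𝒰 h𝒰) (v : G) :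
    |β (u * v) - β u - β v| ≤ 2 * δ + 3 := by
  have hu' : ∀ R : ℝ, ∀ᶠ y in 𝒰, R < gromovProd (wordMetric hS) 1 y (u⁻¹ * y) :=
    Subgroup.inv_mem _ hu
  obtain ⟨y, h1, h2, h3, h4⟩ := ((hu' (wordMetric hS 1 v)).and
    ((hβ u).and ((hβ v).and (hβ (u * v))))).exists
  have e1 := hδ.abs_gromovProd_sub_le h1.le
  have e2 : wordMetric hS (u * v) y = wordMetric hS v (u⁻¹ * y) := by
    rw [← wordMetric_mul_left hS u v (u⁻¹ * y), mul_inv_cancel_left]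
  have e3 : wordMetric hS u y = wordMetric hS 1 (u⁻¹ * y) := by
    rw [← wordMetric_mul_left hS u 1 (u⁻¹ * y), mul_inv_cancel_left, mul_one]
  rw [e2] at h4
  rw [e3] at h2
  simp only [gromovProd, (wordMetric hS).symm v 1, (wordMetric hS).symm _ 1] at e1
  rw [abs_le] at *
  constructor <;> linarith

/-- The Busemann function is proper on the stabilizer of the direction: elements with bounded
values move a far away point of a geodesic in this direction by a bounded amount. -/
theorem finite_setOf_abs_busemann_le (hδ : HyperbolicWith (wordMetric hS) δ) {β : G → ℝ}
    (hβ : ∀ u, ∀ᶠ y in 𝒰, |wordMetric hS u y - wordMetric hS 1 y - β u| ≤ 1) (K : ℝ) :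
    {u | u ∈ directionStabilizer hδ 𝒰 h𝒰 ∧ |β u| ≤ K}.Finite := by
  have hδ0 := hδ.1
  set E := (6 * δ + 2 * K + 7) / 2 with hE
  have hfin := finite_setOf_wordMetric_le hS (2 * E + 2 * δ)
  by_contra hinf
  obtain ⟨F, hF, hcard⟩ := Set.Infinite.exists_subset_card_eq hinf (hfin.toFinset.card + 1)
  obtain ⟨N, hN⟩ := (F.finite_toSet.image fun u => wordMetric hS 1 u).bddAbove
  obtain ⟨T, hT⟩ := exists_nat_ge N
  have hev : ∀ᶠ y in 𝒰, ∀ u ∈ F, (T : ℝ) < gromovProd (wordMetric hS) 1 y (u⁻¹ * y) ∧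
      |wordMetric hS u y - wordMetric hS 1 y - β u| ≤ 1 ∧
      |wordMetric hS u⁻¹ y - wordMetric hS 1 y - β u⁻¹| ≤ 1 := by
    rw [Filter.eventually_all_finset]
    intro u hu
    have hu' : ∀ R : ℝ, ∀ᶠ y in 𝒰, R < gromovProd (wordMetric hS) 1 y (u⁻¹ * y) :=
      Subgroup.inv_mem _ (hF hu).1
    exact (hu' T).and ((hβ u).and (hβ u⁻¹))
  obtain ⟨y, hy, hyT, hy1⟩ := (hev.and ((h𝒰 T).and (hβ 1))).exists
  obtain ⟨n, c, hc0, hcn, hc⟩ := isDiscreteGeodesic_wordMetric hS 1 y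
  have hn : wordMetric hS 1 y = n := by
    rw [← hc0, ← hcn, hc 0 n (Nat.zero_le n) le_rfl]; simp
  have hTn : T ≤ n := by rw [hn] at hyT; exact_mod_cast hyT.le
  set p := c T with hp
  have h1p : wordMetric hS 1 p = T := by rw [← hc0, hc 0 T (Nat.zero_le T) hTn]; simp
  have hpy : wordMetric hS p y = wordMetric hS 1 y - T := by
    rw [hn, ← hcn, hc T n hTn le_rfl]
  have hgp : gromovProd (wordMetric hS) 1 p y = T := by
    simp only [gromovProd, (wordMetric hS).symm p 1, (wordMetric hS).symm y 1, h1p, hpy]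
    ring
  -- `T` bounds the lengths of all `u ∈ F`, so `p` lies beyond the branch point of `1`, `u` and `y`
  -- and `u * p` is close to the geodesic; the values of `β` locate it near `p`, with a bound that
  -- does not depend on `F`
  have key : ∀ u ∈ F, p⁻¹ * (u * p) ∈ hfin.toFinset := by
    intro u hu
    obtain ⟨a1, a2, a3⟩ := hy u hu
    have hβu : |β u| ≤ K := (hF hu).2
    have huN : wordMetric hS 1 u⁻¹ ≤ T := by
      rw [dist_one_inv (wordMetric_mul_left hS)]
      exact (hN ⟨u, hu, rfl⟩).trans hT
    have e1 := hδ.abs_gromovProd_sub_le (w := 1) (v := u⁻¹) (y := p) (y' := y)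
      (by rw [hgp]; exact huN)
    have e2 := hδ.abs_gromovProd_sub_le (w := 1) (v := p) (y := y) (y' := u⁻¹ * y)
      (by rw [h1p]; exact a1.le)
    have hβinv := abs_busemann_mul_le hδ hβ (hF hu).1 u⁻¹
    rw [mul_inv_cancel] at hβinv
    have f1 : wordMetric hS u⁻¹ p = wordMetric hS 1 (u * p) := by
      rw [← wordMetric_mul_left hS u u⁻¹ p, mul_inv_cancel]
    have f2 : wordMetric hS p (u⁻¹ * y) = wordMetric hS (u * p) y := by
      rw [← wordMetric_mul_left hS u p (u⁻¹ * y), mul_inv_cancel_left]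
    have f3 : wordMetric hS 1 (u⁻¹ * y) = wordMetric hS u y := by
      rw [← wordMetric_mul_left hS u 1 (u⁻¹ * y), mul_inv_cancel_left, mul_one]
    have e3 := hδ.dist_le 1 y p (u * p)
    have f4 : gromovProd (wordMetric hS) p 1 y = 0 := by
      simp only [gromovProd, (wordMetric hS).symm y p, h1p, hpy]; ring
    rw [hgp, f4] at e3
    have f5 : |(T : ℝ) - gromovProd (wordMetric hS) 1 (u * p) y| ≤ E ∧
        gromovProd (wordMetric hS) (u * p) 1 y ≤ E := by
      simp only [gromovProd, (wordMetric hS).symm _ (1 : G), (wordMetric hS).symm y (u * p),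
        f1, f2, f3, h1p, hpy] at *
      simp only [abs_le] at *
      refine ⟨⟨?_, ?_⟩, ?_⟩ <;> linarith
    rw [Set.Finite.mem_toFinset]
    change wordMetric hS 1 (p⁻¹ * (u * p)) ≤ _
    rw [← wordMetric_mul_left hS p 1, mul_one, mul_inv_cancel_left]
    linarith [f5.1, f5.2]
  have := Finset.card_le_card_of_injOn (fun u => p⁻¹ * (u * p)) key
    (fun u _ v _ huv => by simpa using huv)
  omega

/-- If some direction has a stabilizer of finite index, then the group is virtually abelian. -/
theorem isVirtuallyAbelian_of_finiteIndex (hδ : HyperbolicWith (wordMetric hS) δ)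
    (hfin : (directionStabilizer hδ 𝒰 h𝒰).FiniteIndex) : IsVirtuallyAbelian G := by
  set H := directionStabilizer hδ 𝒰 h𝒰 with hH
  have hδ0 := hδ.1
  obtain ⟨β, hβ⟩ := exists_busemann hS 𝒰
  have hq : ∀ u ∈ H, ∀ v, |β (u * v) - β u - β v| ≤ 2 * δ + 3 := fun u hu v =>
    abs_busemann_mul_le hδ hβ hu v
  -- if `β` is bounded on `H`, then `t = 1` will do, and `H` is finite
  obtain ⟨t, ht, K, hK⟩ : ∃ t ∈ H, ∃ K, ∀ g ∈ H, ∃ n : ℤ, |β (t ^ n * g)| ≤ K := by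
    by_cases h : ∃ t ∈ H, 2 * δ + 3 + 1 ≤ |β t|
    · obtain ⟨t, ht, hβt⟩ := h
      rcases abs_cases (β t) with ⟨h', -⟩ | ⟨h', -⟩
      · exact ⟨t, ht, _, fun g _ => exists_abs_zpow_mul_le (by linarith) (hq t ht)
          (by linarith) g⟩
      · refine ⟨t, ht, -β t + (2 * δ + 3), fun g _ => ?_⟩
        obtain ⟨n, hn⟩ := exists_abs_zpow_mul_le (β := fun u => -β u) (t := t)
          (D := 2 * δ + 3) (by linarith) (fun v => by
            have := hq t ht v
            rw [← abs_neg] at this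
            convert this using 2
            ring) (by linarith) g
        exact ⟨n, by simpa using hn⟩
    · push Not at h
      exact ⟨1, H.one_mem, _, fun g hg => ⟨0, by simpa using (h g hg).le⟩⟩
  refine ⟨Subgroup.zpowers t, ?_, ?_⟩
  · have hF := finite_setOf_abs_busemann_le (h𝒰 := h𝒰) hδ hβ K
    set F := {u | u ∈ directionStabilizer hδ 𝒰 h𝒰 ∧ |β u| ≤ K}
    have : Finite F := hF
    have hsurj : Function.Surjective (fun q : (G ⧸ H) × F =>
        (QuotientGroup.mk (q.1.out * (q.2 : G)⁻¹) : G ⧸ Subgroup.zpowers t)) := by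
      intro x
      obtain ⟨g, rfl⟩ := QuotientGroup.mk_surjective x
      have hg : (QuotientGroup.mk g : G ⧸ H).out⁻¹ * g ∈ H :=
        QuotientGroup.eq.1 (QuotientGroup.out_eq' _)
      obtain ⟨n, hn⟩ := hK _ (H.inv_mem hg)
      refine ⟨⟨QuotientGroup.mk g, ⟨_, H.mul_mem (H.zpow_mem ht n) (H.inv_mem hg), hn⟩⟩, ?_⟩
      refine QuotientGroup.eq.2 ⟨n, ?_⟩
      simp only
      group
    have := Finite.of_surjective _ hsurj
    exact Subgroup.finiteIndex_of_finite_quotient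
  · rintro _ ⟨m, rfl⟩ _ ⟨n, rfl⟩
    exact ((Commute.refl t).zpow_zpow m n).eq

/-! ### Moving points into general position -/

/-- In a hyperbolic group that is not virtually abelian, any point can be moved away from two given
directions by an element of bounded length. Otherwise an ultrafilter of counterexamples has a
direction whose orbit has at most two points, so that its stabilizer has finite index. -/
theorem exists_general_position (hδ : HyperbolicWith (wordMetric hS) δ)
    (hne : ¬ IsVirtuallyAbelian G) :
    ∃ R : ℝ, ∀ y z₁ z₂ : G, ∃ u : G, wordMetric hS 1 u ≤ R ∧
      gromovProd (wordMetric hS) 1 z₁ (u * y) ≤ R ∧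
      gromovProd (wordMetric hS) 1 z₂ (u * y) ≤ R := by
  by_contra! hcon
  choose y z₁ z₂ hbad using fun n : ℕ => hcon n
  set 𝒱 : Ultrafilter ℕ := Ultrafilter.of Filter.atTop
  have hlarge : ∀ R : ℝ, ∀ᶠ n : ℕ in 𝒱, R < n := fun R =>
    Ultrafilter.of_le _ (tendsto_natCast_atTop_atTop.eventually_gt_atTop R)
  have hbad' : ∀ (n : ℕ) (u : G), wordMetric hS 1 u ≤ n →
      (n : ℝ) < gromovProd (wordMetric hS) 1 (z₁ n) (u * y n) ∨
      (n : ℝ) < gromovProd (wordMetric hS) 1 (z₂ n) (u * y n) := by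
    intro n u hu
    by_cases h : gromovProd (wordMetric hS) 1 (z₁ n) (u * y n) ≤ n
    · exact Or.inr (hbad n u hu h)
    · exact Or.inl (not_le.1 h)
  set 𝒰 := 𝒱.map y
  have h𝒰 : ∀ R : ℝ, ∀ᶠ x in 𝒰, R < wordMetric hS 1 x := by
    intro R
    change ∀ᶠ n in 𝒱, R < wordMetric hS 1 (y n)
    filter_upwards [hlarge R] with n hn
    have h1 := gromovProd_le' (wordMetric hS) 1 (z₁ n) (y n)
    have h2 := gromovProd_le' (wordMetric hS) 1 (z₂ n) (y n)
    have h3 := hbad' n 1 (by simp)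
    rw [one_mul] at h3
    rcases h3 with h3 | h3 <;> linarith
  have hindex : ¬ (directionStabilizer hδ 𝒰 h𝒰).FiniteIndex := fun h =>
    hne (isVirtuallyAbelian_of_finiteIndex hδ h)
  have hinf : Infinite (G ⧸ directionStabilizer hδ 𝒰 h𝒰) := by
    rw [← not_finite_iff_infinite]
    exact fun _ => hindex Subgroup.finiteIndex_of_finite_quotient
  set q := Infinite.natEmbedding (G ⧸ directionStabilizer hδ 𝒰 h𝒰)
  have hsep : ∀ i j, i ≠ j → ∃ R : ℝ, ∀ᶠ n in 𝒱,
      gromovProd (wordMetric hS) 1 ((q i).out * y n) ((q j).out * y n) ≤ R := by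
    intro i j hij
    have hnot : (q i).out⁻¹ * (q j).out ∉ directionStabilizer hδ 𝒰 h𝒰 := by
      intro h
      have := QuotientGroup.eq.2 h
      rw [QuotientGroup.out_eq', QuotientGroup.out_eq'] at this
      exact hij (q.injective this)
    have : ¬ ∀ R : ℝ, ∀ᶠ x in 𝒰,
        R < gromovProd (wordMetric hS) 1 x ((q i).out⁻¹ * (q j).out * x) := hnot
    push Not at this
    obtain ⟨R, hR⟩ := this
    refine ⟨R + wordMetric hS 1 (q i).out, ?_⟩
    have hR' : ∀ᶠ n in 𝒱,
        gromovProd (wordMetric hS) 1 (y n) ((q i).out⁻¹ * (q j).out * y n) ≤ R := hR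
    filter_upwards [hR'] with n hn
    have h := gromovProd_one_mul_left_le (wordMetric_mul_left hS) (q i).out (y n)
      ((q i).out⁻¹ * (q j).out * y n)
    rw [mul_assoc, mul_inv_cancel_left, ← mul_assoc] at h
    linarith
  obtain ⟨R₁, h₁⟩ := hsep 0 1 (by decide)
  obtain ⟨R₂, h₂⟩ := hsep 0 2 (by decide)
  obtain ⟨R₃, h₃⟩ := hsep 1 2 (by decide)
  obtain ⟨n, a₁, a₂, a₃, b₁, b₂, b₃, c₁, c₂, c₃⟩ := (h₁.and (h₂.and (h₃.and
    ((hlarge (R₁ + δ)).and ((hlarge (R₂ + δ)).and ((hlarge (R₃ + δ)).and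
    ((hlarge (wordMetric hS 1 (q 0).out)).and ((hlarge (wordMetric hS 1 (q 1).out)).and
    (hlarge (wordMetric hS 1 (q 2).out)))))))))).exists
  -- two of the three translates are close to the same direction
  have clash : ∀ (z u v : G) (R : ℝ), R + δ < n →
      (n : ℝ) < gromovProd (wordMetric hS) 1 z (u * y n) →
      (n : ℝ) < gromovProd (wordMetric hS) 1 z (v * y n) →
      gromovProd (wordMetric hS) 1 (u * y n) (v * y n) ≤ R → False := by
    intro z u v R hR hu hv huv
    have h := hδ.2 (u * y n) z (v * y n) 1
    rw [gromovProd_comm _ 1 (u * y n) z] at h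
    have := lt_min hu hv
    linarith
  rcases hbad' n _ c₁.le with d₁ | d₁ <;> rcases hbad' n _ c₂.le with d₂ | d₂ <;>
    rcases hbad' n _ c₃.le with d₃ | d₃
  · exact clash _ _ _ _ b₁ d₁ d₂ a₁
  · exact clash _ _ _ _ b₁ d₁ d₂ a₁
  · exact clash _ _ _ _ b₂ d₁ d₃ a₂
  · exact clash _ _ _ _ b₃ d₂ d₃ a₃
  · exact clash _ _ _ _ b₃ d₂ d₃ a₃
  · exact clash _ _ _ _ b₂ d₁ d₃ a₂
  · exact clash _ _ _ _ b₁ d₁ d₂ a₁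
  · exact clash _ _ _ _ b₁ d₁ d₂ a₁

/-- Every element becomes cyclically reduced, up to a bounded error, after multiplication by an
element of bounded length. -/
theorem exists_mul_gromovProd_inv_le (hδ : HyperbolicWith (wordMetric hS) δ)
    (hne : ¬ IsVirtuallyAbelian G) :
    ∃ C : ℝ, ∀ g : G, ∃ v : G, wordMetric hS 1 v ≤ C ∧
      gromovProd (wordMetric hS) 1 (g * v) (g * v)⁻¹ ≤ C := by
  obtain ⟨R, hR⟩ := exists_general_position hδ hne
  refine ⟨2 * R, fun g => ?_⟩
  obtain ⟨u, hu, h, -⟩ := hR g⁻¹ g g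
  have hu' := dist_one_inv (wordMetric_mul_left hS) u
  have h0 := (wordMetric hS).nonneg 1 u
  refine ⟨u⁻¹, by linarith, ?_⟩
  have h1 := gromovProd_left_le (wordMetric hS) 1 (g * u⁻¹) g (u * g⁻¹)
  have h2 : wordMetric hS (g * u⁻¹) g = wordMetric hS 1 u⁻¹ := by
    rw [(wordMetric hS).symm, ← wordMetric_mul_left hS g 1 u⁻¹, mul_one]
  rw [mul_inv_rev, inv_inv]
  linarith

end Direction

/-! ### Stable translation lengths -/

/-- The stable translation length `lim d(1, gⁿ) / n`, defined as an infimum; it is the limit for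
left-invariant `d`. -/
def stableLength {G : Type*} [Group G] (d : G → G → ℝ) (g : G) : ℝ :=
  sInf ((fun n : ℕ => d 1 (g ^ n) / n) '' Set.Ici 1)

section StableLength

variable {G : Type*} [Group G] {d e : PseudoMetric G ℝ}

theorem tendsto_stableLength (hinv : ∀ g x y : G, d (g * x) (g * y) = d x y) (g : G) :
    Filter.Tendsto (fun n : ℕ => d 1 (g ^ n) / n) Filter.atTop (nhds (stableLength d g)) := by
  have hsub : Subadditive fun n : ℕ => d 1 (g ^ n) := by
    intro m n
    have h1 := d.triangle 1 (g ^ m) (g ^ (m + n))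
    have h2 := hinv (g ^ m) 1 (g ^ n)
    rw [mul_one, ← pow_add] at h2
    linarith
  have h := hsub.tendsto_lim ⟨0, by
    rintro _ ⟨n, rfl⟩
    exact div_nonneg (d.nonneg _ _) (Nat.cast_nonneg n)⟩
  rwa [Subadditive.lim] at h

theorem stableLength_nonneg (hinv : ∀ g x y : G, d (g * x) (g * y) = d x y) (g : G) :
    0 ≤ stableLength d g :=
  ge_of_tendsto' (tendsto_stableLength hinv g) fun n =>
    div_nonneg (d.nonneg _ _) (Nat.cast_nonneg n)

theorem stableLength_le (g : G) : stableLength d g ≤ d 1 g :=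
  csInf_le ⟨0, by
    rintro _ ⟨n, -, rfl⟩
    exact div_nonneg (d.nonneg _ _) (Nat.cast_nonneg n)⟩ ⟨1, Set.mem_Ici.2 le_rfl, by simp⟩

theorem stableLength_le_mul (hd : ∀ g x y : G, d (g * x) (g * y) = d x y)
    (he : ∀ g x y : G, e (g * x) (g * y) = e x y) {l A : ℝ}
    (h : ∀ x y, d x y ≤ l * e x y + A) (g : G) : stableLength d g ≤ l * stableLength e g := by
  have h1 := ((tendsto_stableLength he g).const_mul l).add
    (tendsto_const_div_atTop_nhds_zero_nat A)
  rw [add_zero] at h1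
  refine le_of_tendsto_of_tendsto' (tendsto_stableLength hd g) h1 fun n => ?_
  rw [← mul_div_assoc, ← add_div]
  exact div_le_div_of_nonneg_right (h _ _) (Nat.cast_nonneg n)

/-- In a hyperbolic pseudometric, a cyclically reduced element has stable length close to its
length. -/
theorem HyperbolicWith.le_stableLength {δ : ℝ} (hδ : HyperbolicWith d δ)
    (hinv : ∀ g x y : G, d (g * x) (g * y) = d x y) (g : G) :
    d 1 g - 2 * gromovProd d 1 g g⁻¹ - 2 * δ ≤ stableLength d g := by
  have h0 := hδ.1
  set c := d 1 g - 2 * gromovProd d 1 g g⁻¹ - 2 * δ with hc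
  rcases le_or_gt c 0 with hc0 | hc0
  · exact hc0.trans (stableLength_nonneg hinv g)
  have hsq : d 1 (g ^ 2) = 2 * d 1 g - 2 * gromovProd d 1 g g⁻¹ := by
    have h1 := hinv g g⁻¹ g
    rw [mul_inv_cancel, ← pow_two] at h1
    have h2 := dist_one_inv hinv g
    simp only [gromovProd, d.symm g 1, d.symm g⁻¹ 1, h2, d.symm g g⁻¹, h1]
    ring
  have hshift : ∀ k m n : ℕ, d (g ^ (k + m)) (g ^ (k + n)) = d (g ^ m) (g ^ n) := fun k m n => by
    rw [pow_add, pow_add, hinv]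
  -- four point inequality for `1`, `g`, `g ^ 2` and `g ^ (n + 2)`
  have step : ∀ n : ℕ, d 1 (g ^ n) + c ≤ d 1 (g ^ (n + 1)) := by
    intro n
    induction n with
    | zero =>
      have := gromovProd_nonneg d 1 g g⁻¹
      simp only [pow_zero, d.refl, zero_add, pow_one]
      linarith
    | succ n ih =>
      have h1 := hδ.four_point 1 g (g ^ 2) (g ^ (n + 2))
      have h2 : d g (g ^ (n + 2)) = d 1 (g ^ (n + 1)) := by
        have := hshift 1 0 (n + 1)
        rwa [pow_zero, pow_one, add_comm 1 (n + 1)] at this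
      have h3 : d (g ^ 2) (g ^ (n + 2)) = d 1 (g ^ n) := by
        have := hshift 2 0 n
        rwa [pow_zero, add_comm 2 n] at this
      have h4 : d g (g ^ 2) = d 1 g := by
        have := hshift 1 0 1; simpa using this
      rw [h2, h3, h4, hsq] at h1
      rcases max_cases (d 1 g + d 1 (g ^ n)) (d 1 g + d 1 (g ^ (n + 2))) with h | h <;>
        linarith
  have hlin : ∀ n : ℕ, n * c ≤ d 1 (g ^ n) := by
    intro n
    induction n with
    | zero => simp
    | succ n ih => have := step n; push_cast; linarith
  refine ge_of_tendsto (tendsto_stableLength hinv g) ?_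
  filter_upwards [Filter.eventually_gt_atTop 0] with n hn
  rw [le_div_iff₀ (by exact_mod_cast hn), mul_comm]
  exact hlin n

end StableLength

section Nonelementary

variable {G : Type*} [Group G] {S : Set G} {hS : IsFiniteSymmGenSet S} {δ : ℝ}

theorem infinite_of_not_isVirtuallyAbelian (hne : ¬ IsVirtuallyAbelian G) : Infinite G := by
  rw [← not_finite_iff_infinite]
  intro _
  refine hne ⟨⊥, inferInstance, fun a ha b hb => ?_⟩
  rw [Subgroup.mem_bot.1 ha, Subgroup.mem_bot.1 hb]

theorem exists_lt_wordMetric (hS : IsFiniteSymmGenSet S) (hne : ¬ IsVirtuallyAbelian G) (R : ℝ) :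
    ∃ g, R < wordMetric hS 1 g := by
  have := infinite_of_not_isVirtuallyAbelian hne
  by_contra! h
  exact Set.infinite_univ ((finite_setOf_wordMetric_le hS R).subset fun g _ => h g)

/-- For every hyperbolic pseudometric, distances from the identity are stable lengths up to a
bounded error and multiplication by elements of bounded length. -/
theorem exists_le_stableLength_mul (hδ : HyperbolicWith (wordMetric hS) δ)
    (hne : ¬ IsVirtuallyAbelian G) {d : PseudoMetric G ℝ} (hd : d ∈ hypPseudometrics G) :
    ∃ C : ℝ, ∀ g : G, ∃ v : G, wordMetric hS 1 v ≤ C ∧ d 1 g ≤ stableLength d (g * v) + C := by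
  obtain ⟨hinv, ⟨L, ε, hL, hε, h⟩, hP⟩ := (mem_hypPseudometrics_iff hδ d).1 hd
  obtain ⟨δ', hδ'⟩ := hd.1
  obtain ⟨C, hC⟩ := exists_mul_gromovProd_inv_le hδ hne
  obtain ⟨C', hC'⟩ := hP C
  refine ⟨max C (2 * C' + 2 * δ' + (L * C + ε)), fun g => ?_⟩
  obtain ⟨v, hv, hgv⟩ := hC g
  refine ⟨v, hv.trans (le_max_left _ _), ?_⟩
  have h1 := HyperbolicWith.le_stableLength hδ' hinv (g * v)
  have h2 := hC' _ _ _ hgv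
  have h3 := d.triangle 1 (g * v) g
  have h4 : d (g * v) g = d 1 v := by
    have := hinv g 1 v
    rw [mul_one] at this
    rw [d.symm, this]
  have h5 := (h 1 v).1
  have h6 := mul_le_mul_of_nonneg_left hv hL.le
  have h7 := le_max_right C (2 * C' + 2 * δ' + (L * C + ε))
  linarith

/-- A comparison of stable lengths is a comparison of pseudometrics up to a bounded error. -/
theorem exists_le_mul_add_of_stableLength_le (hδ : HyperbolicWith (wordMetric hS) δ)
    (hne : ¬ IsVirtuallyAbelian G) {d e : PseudoMetric G ℝ} (hd : d ∈ hypPseudometrics G)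
    (he : e ∈ hypPseudometrics G) {k : ℝ} (hk : 0 ≤ k)
    (h : ∀ g, stableLength d g ≤ k * stableLength e g) :
    ∃ A : ℝ, 0 ≤ A ∧ ∀ x y, d x y ≤ k * e x y + A := by
  obtain ⟨C, hC⟩ := exists_le_stableLength_mul hδ hne hd
  obtain ⟨hinv, ⟨L, ε, hL, hε, hL'⟩, -⟩ := (mem_hypPseudometrics_iff hδ e).1 he
  have key : ∀ g, d 1 g ≤ k * e 1 g + (k * (L * |C| + ε) + |C|) := by
    intro g
    obtain ⟨v, hv, hg⟩ := hC g
    have h1 := mul_le_mul_of_nonneg_left (stableLength_le (d := e) (g * v)) hk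
    have h2 := e.triangle 1 g (g * v)
    have h3 := hinv g 1 v
    rw [mul_one] at h3
    have h4 := (hL' 1 v).1
    have h5 := mul_le_mul_of_nonneg_left (hv.trans (le_abs_self C)) hL.le
    have h6 := mul_le_mul_of_nonneg_left (h2.trans (by linarith :
      e 1 g + e g (g * v) ≤ e 1 g + (L * |C| + ε))) hk
    have := h (g * v)
    have := le_abs_self C
    linarith
  refine ⟨k * (L * |C| + ε) + |C|, by positivity, fun x y => ?_⟩
  have h1 := ((mem_hypPseudometrics_iff hδ d).1 hd).1 x 1 (x⁻¹ * y)
  have h2 := hinv x 1 (x⁻¹ * y)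
  rw [mul_one, mul_inv_cancel_left] at h1 h2
  rw [h1, h2]
  exact key _

theorem exists_stableLength_pos (hδ : HyperbolicWith (wordMetric hS) δ)
    (hne : ¬ IsVirtuallyAbelian G) : ∃ a : G, ∀ d ∈ hypPseudometrics G, 0 < stableLength d a := by
  have hs := wordMetric_mem_hypPseudometrics hδ hS
  obtain ⟨C, hC⟩ := exists_le_stableLength_mul hδ hne hs
  obtain ⟨g, hg⟩ := exists_lt_wordMetric hS hne C
  obtain ⟨v, -, hv⟩ := hC g
  refine ⟨g * v, fun d hd => ?_⟩
  obtain ⟨hinv, ⟨L, ε, hL, hε, h⟩, -⟩ := (mem_hypPseudometrics_iff hδ d).1 hd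
  have := stableLength_le_mul (wordMetric_mul_left hS) hinv (fun x y => (h x y).2) (g * v)
  exact pos_of_mul_pos_right (by linarith) hL.le

/-! ### Exponential growth -/

/-- Ping-pong for a pair of long elements in general position: a product does not backtrack into
the inverse of a generator. -/
theorem HyperbolicWith.gromovProd_inv_prod_le (hδ : HyperbolicWith (wordMetric hS) δ) {C : ℝ}
    (hC0 : 0 ≤ C) {c : Bool → G}
    (hC : ∀ i j, gromovProd (wordMetric hS) 1 (c i)⁻¹ (c j) ≤ C)
    (hlong : ∀ i, 2 * C + 3 * δ < wordMetric hS 1 (c i)) (l : List Bool) :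
    ∀ i, gromovProd (wordMetric hS) 1 (c i)⁻¹ (l.map c).prod ≤ C + δ := by
  have h0 := hδ.1
  induction l with
  | nil =>
    intro i
    have := gromovProd_le' (wordMetric hS) 1 (c i)⁻¹ 1
    simp only [(wordMetric hS).refl] at this
    simp only [List.map_nil, List.prod_nil]
    linarith
  | cons j l ih =>
    intro i
    rw [List.map_cons, List.prod_cons]
    have h1 := ih j
    have h2 := gromovProd_add (wordMetric hS) 1 (c j) (c j * (l.map c).prod)
    have h3 := gromovProd_mul_left (wordMetric_mul_left hS) (c j) 1 (c j)⁻¹ (l.map c).prod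
    rw [mul_one, mul_inv_cancel] at h3
    refine (hδ.min_le (hC i j) (c j * (l.map c).prod)).resolve_right ?_
    rw [gromovProd_comm]
    have := hlong j
    linarith

theorem HyperbolicWith.injective_prod (hδ : HyperbolicWith (wordMetric hS) δ) {C : ℝ}
    (hC0 : 0 ≤ C) {c : Bool → G}
    (hC : ∀ i j, gromovProd (wordMetric hS) 1 (c i)⁻¹ (c j) ≤ C)
    (hC' : ∀ i j, i ≠ j → gromovProd (wordMetric hS) 1 (c i) (c j) ≤ C)
    (hlong : ∀ i, 2 * C + 3 * δ < wordMetric hS 1 (c i)) (l : List Bool) :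
    ∀ l' : List Bool, l.length = l'.length → (l.map c).prod = (l'.map c).prod → l = l' := by
  have h0 := hδ.1
  have hfirst : ∀ (j : Bool) (m : List Bool),
      C + 2 * δ < gromovProd (wordMetric hS) 1 (c j) (c j * (m.map c).prod) := by
    intro j m
    have h1 := hδ.gromovProd_inv_prod_le hC0 hC hlong m j
    have h2 := gromovProd_add (wordMetric hS) 1 (c j) (c j * (m.map c).prod)
    have h3 := gromovProd_mul_left (wordMetric_mul_left hS) (c j) 1 (c j)⁻¹ (m.map c).prod
    rw [mul_one, mul_inv_cancel] at h3
    have := hlong j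
    linarith
  induction l with
  | nil => intro l' hl' _; exact (List.length_eq_zero_iff.1 hl'.symm).symm
  | cons i l ih =>
    intro l' hl' heq
    cases l' with
    | nil => simp at hl'
    | cons j l' =>
      rw [List.map_cons, List.prod_cons, List.map_cons, List.prod_cons] at heq
      by_cases hij : i = j
      · subst hij
        rw [ih l' (by simpa using hl') (mul_left_cancel heq)]
      · have h1 := hfirst i l
        have h2 := hfirst j l'
        rw [← heq, gromovProd_comm] at h2
        rcases hδ.min_le (hC' i j hij) (c i * (l.map c).prod) with h | h <;> linarith

/-- A non-elementary hyperbolic group has exponential growth, because it contains a free semigroup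
on two generators. -/
theorem exists_two_pow_le_card (hδ : HyperbolicWith (wordMetric hS) δ)
    (hne : ¬ IsVirtuallyAbelian G) : ∃ M : ℝ, 0 < M ∧ ∀ (k : ℕ) (F : Finset G),
      (∀ g, wordMetric hS 1 g ≤ k * M → g ∈ F) → 2 ^ k ≤ F.card := by
  have h0 := hδ.1
  obtain ⟨C, hC⟩ := exists_mul_gromovProd_inv_le hδ hne
  obtain ⟨R, hR⟩ := exists_general_position hδ hne
  set K := |C| + 2 * |R| with hK
  obtain ⟨g, hg⟩ := exists_lt_wordMetric hS hne (2 * K + 3 * δ + |C| + |R|)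
  obtain ⟨v, hv, hgv⟩ := hC g
  set a := g * v with ha
  obtain ⟨u, hu, h1, h2⟩ := hR a a a⁻¹
  have aC := le_abs_self C
  have aR := le_abs_self R
  have hCn := abs_nonneg C
  have hRn := abs_nonneg R
  -- the second generator points in a direction away from `a` and `a⁻¹`, its inverse points in the
  -- direction of `a⁻¹`
  set c : Bool → G := fun i => if i then a else u * a with hc
  have ct : c true = a := rfl
  have cf : c false = u * a := rfl
  have hlena : 2 * K + 3 * δ + |R| < wordMetric hS 1 a := by
    have h3 := (wordMetric hS).triangle 1 a g
    have h4 : wordMetric hS a g = wordMetric hS 1 v := by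
      rw [(wordMetric hS).symm, ← wordMetric_mul_left hS g 1 v, mul_one]
    linarith
  have hlong : ∀ i, 2 * K + 3 * δ < wordMetric hS 1 (c i) := by
    intro i
    cases i
    · rw [cf]
      have h3 := (wordMetric hS).triangle u 1 (u * a)
      have h4 := wordMetric_mul_left hS u 1 a
      rw [mul_one] at h4
      rw [(wordMetric hS).symm u 1] at h3
      linarith
    · rw [ct]; linarith
  have hinv : ∀ z, gromovProd (wordMetric hS) 1 (u * a)⁻¹ z ≤
      gromovProd (wordMetric hS) 1 a⁻¹ z + |R| := by
    intro z
    have h3 := gromovProd_left_le (wordMetric hS) 1 (u * a)⁻¹ a⁻¹ z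
    have h4 := wordMetric_mul_left hS a⁻¹ u⁻¹ 1
    rw [mul_one, ← mul_inv_rev, (wordMetric hS).symm u⁻¹,
      dist_one_inv (wordMetric_mul_left hS)] at h4
    linarith
  rw [gromovProd_comm] at hgv
  have hpair : ∀ i j, gromovProd (wordMetric hS) 1 (c i)⁻¹ (c j) ≤ K := by
    intro i j
    cases i <;> cases j <;> simp only [ct, cf]
    · linarith [hinv (u * a)]
    · linarith [hinv a]
    · linarith
    · linarith
  have hpair' : ∀ i j, i ≠ j → gromovProd (wordMetric hS) 1 (c i) (c j) ≤ K := by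
    intro i j hij
    cases i <;> cases j <;> simp only [ct, cf]
    · exact absurd rfl hij
    · rw [gromovProd_comm]; linarith
    · linarith
    · exact absurd rfl hij
  set M := wordMetric hS 1 a + |R| + 1 with hM
  have hcM : ∀ i, wordMetric hS 1 (c i) ≤ M := by
    intro i
    cases i
    · rw [cf]
      have h3 := (wordMetric hS).triangle 1 u (u * a)
      have h4 := wordMetric_mul_left hS u 1 a
      rw [mul_one] at h4
      linarith
    · rw [ct]; linarith
  have hprod : ∀ l : List Bool, wordMetric hS 1 (l.map c).prod ≤ l.length * M := by
    intro l
    induction l with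
    | nil => simp
    | cons i l ih =>
      rw [List.map_cons, List.prod_cons, List.length_cons]
      have h3 := (wordMetric hS).triangle 1 (c i) (c i * (l.map c).prod)
      have h4 := wordMetric_mul_left hS (c i) 1 (l.map c).prod
      rw [mul_one] at h4
      have := hcM i
      push_cast
      linarith
  refine ⟨M, by have := (wordMetric hS).nonneg 1 a; linarith, fun k F hF => ?_⟩
  have := Finset.card_le_card_of_injOn (s := (Finset.univ : Finset (Fin k → Bool))) (t := F)
    (fun w => ((List.ofFn w).map c).prod)
    (fun w _ => hF _ (by simpa using hprod (List.ofFn w)))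
    (fun w _ w' _ hw => List.ofFn_injective
      (hδ.injective_prod (by positivity) hpair hpair' hlong _ _ (by simp) hw))
  simpa using this

end Nonelementary

/-! ### Coarse domination and the distortion -/

/-- `d ≤ l * e` up to a bounded error. -/
def CoarselyLE {X : Type*} (d e : X → X → ℝ) (l : ℝ) : Prop :=
  ∃ A : ℝ, 0 ≤ A ∧ ∀ x y, d x y ≤ l * e x y + A

theorem CoarselyLE.trans {X : Type*} {d e f : X → X → ℝ} {l m : ℝ} (h : CoarselyLE d e l)
    (h' : CoarselyLE e f m) (hl : 0 ≤ l) : CoarselyLE d f (l * m) := by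
  obtain ⟨A, hA, h⟩ := h
  obtain ⟨B, hB, h'⟩ := h'
  refine ⟨l * B + A, by positivity, fun x y => ?_⟩
  have := mul_le_mul_of_nonneg_left (h' x y) hl
  linarith [h x y]

theorem mem_distortionSet_iff {X : Type*} {d e : X → X → ℝ} {r : ℝ} :
    r ∈ distortionSet d e ↔ ∃ l₁ l₂ : ℝ, 0 < l₁ ∧ 0 < l₂ ∧ r = l₁ * l₂ ∧
      CoarselyLE e d l₁ ∧ CoarselyLE d e l₂ := by
  constructor
  · rintro ⟨l₁, l₂, h₁, h₂, rfl, A, hA, h⟩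
    refine ⟨l₁, l₂, h₁, h₂, rfl, ⟨l₁ * A, by positivity, fun x y => ?_⟩, A, hA,
      fun x y => (h x y).2⟩
    have := mul_le_mul_of_nonneg_left (h x y).1 h₁.le
    have e1 : l₁ * (1 / l₁ * e x y - A) = e x y - l₁ * A := by field_simp
    linarith
  · rintro ⟨l₁, l₂, h₁, h₂, rfl, ⟨A, hA, h⟩, B, hB, h'⟩
    refine ⟨l₁, l₂, h₁, h₂, rfl, A / l₁ + B, by positivity, fun x y => ⟨?_, ?_⟩⟩
    · have := mul_le_mul_of_nonneg_left (h x y) (one_div_pos.2 h₁).le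
      have e1 : 1 / l₁ * (l₁ * d x y + A) = d x y + A / l₁ := by field_simp
      linarith
    · have := h' x y
      have : 0 ≤ A / l₁ := by positivity
      linarith

theorem distortionSet_comm {X : Type*} (d e : X → X → ℝ) :
    distortionSet d e = distortionSet e d := by
  ext r
  simp only [mem_distortionSet_iff]
  constructor <;> rintro ⟨l₁, l₂, h₁, h₂, rfl, h, h'⟩ <;>
    exact ⟨l₂, l₁, h₂, h₁, mul_comm _ _, h', h⟩

theorem one_mem_distortionSet {X : Type*} (d : X → X → ℝ) : 1 ∈ distortionSet d d :=
  mem_distortionSet_iff.2 ⟨1, 1, one_pos, one_pos, by simp, ⟨0, le_rfl, by simp⟩,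
    ⟨0, le_rfl, by simp⟩⟩

theorem mul_mem_distortionSet {X : Type*} {d e f : X → X → ℝ} {r q : ℝ}
    (hr : r ∈ distortionSet d e) (hq : q ∈ distortionSet e f) : r * q ∈ distortionSet d f := by
  obtain ⟨l₁, l₂, h₁, h₂, rfl, h, h'⟩ := mem_distortionSet_iff.1 hr
  obtain ⟨m₁, m₂, k₁, k₂, rfl, k, k'⟩ := mem_distortionSet_iff.1 hq
  exact mem_distortionSet_iff.2 ⟨m₁ * l₁, l₂ * m₂, by positivity, by positivity, by ring,
    k.trans h k₁.le, h'.trans k' h₂.le⟩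

theorem le_csInf_mul {s : Set ℝ} (hs : s.Nonempty) {c x : ℝ} (hx : 0 ≤ x)
    (h : ∀ r ∈ s, c ≤ r * x) : c ≤ sInf s * x := by
  rcases hx.eq_or_lt with rfl | hx
  · obtain ⟨r, hr⟩ := hs
    simpa using h r hr
  · rw [← div_le_iff₀ hx]
    exact le_csInf hs fun r hr => (div_le_iff₀ hx).2 (h r hr)

section Distortion

open scoped Pointwise

variable {G : Type*} [Group G] {S : Set G} {hS : IsFiniteSymmGenSet S} {δ : ℝ}

theorem CoarselyLE.stableLength_le {d e : PseudoMetric G ℝ} (hd : d ∈ hypPseudometrics G)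
    (he : e ∈ hypPseudometrics G) {l : ℝ} (h : CoarselyLE d e l) (g : G) :
    stableLength d g ≤ l * stableLength e g := by
  obtain ⟨A, -, h⟩ := h
  exact stableLength_le_mul hd.2.1 he.2.1 h g

theorem nonempty_distortionSet (hδ : HyperbolicWith (wordMetric hS) δ) {d e : PseudoMetric G ℝ}
    (hd : d ∈ hypPseudometrics G) (he : e ∈ hypPseudometrics G) :
    (distortionSet d e).Nonempty := by
  obtain ⟨L, ε, hL, hε, h⟩ := ((mem_hypPseudometrics_iff hδ d).1 hd).2.1.trans
    ((mem_hypPseudometrics_iff hδ e).1 he).2.1.symm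
  exact ⟨L * L, mem_distortionSet_iff.2 ⟨L, L, hL, hL, rfl, ⟨ε, hε, fun x y => (h x y).2⟩,
    ⟨ε, hε, fun x y => (h x y).1⟩⟩⟩

theorem one_le_of_mem_distortionSet (hδ : HyperbolicWith (wordMetric hS) δ)
    (hne : ¬ IsVirtuallyAbelian G) {d e : PseudoMetric G ℝ}
    (hd : d ∈ hypPseudometrics G) (he : e ∈ hypPseudometrics G) {r : ℝ}
    (hr : r ∈ distortionSet d e) : 1 ≤ r := by
  obtain ⟨a, ha⟩ := exists_stableLength_pos hδ hne
  obtain ⟨l₁, l₂, h₁, h₂, rfl, h, h'⟩ := mem_distortionSet_iff.1 hr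
  have k := h.stableLength_le he hd a
  have k' := h'.stableLength_le hd he a
  have := mul_le_mul_of_nonneg_left k h₂.le
  have := ha d hd
  by_contra! hlt
  nlinarith

theorem bddBelow_distortionSet {X : Type*} (d e : X → X → ℝ) : BddBelow (distortionSet d e) := by
  refine ⟨0, ?_⟩
  rintro _ ⟨l₁, l₂, h₁, h₂, rfl, -⟩
  positivity

/-- Pseudometrics with distortion one have proportional stable lengths, hence are roughly
similar. -/
theorem areRoughlySimilar_of_sInf_distortionSet (hδ : HyperbolicWith (wordMetric hS) δ)
    (hne : ¬ IsVirtuallyAbelian G) {d e : PseudoMetric G ℝ}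
    (hd : d ∈ hypPseudometrics G) (he : e ∈ hypPseudometrics G)
    (h : sInf (distortionSet d e) = 1) : AreRoughlySimilar d e := by
  obtain ⟨a, ha⟩ := exists_stableLength_pos hδ hne
  have hda := ha d hd
  have hea := ha e he
  have key : ∀ g g' : G,
      stableLength d g * stableLength e g' ≤ stableLength e g * stableLength d g' := by
    intro g g'
    rw [← one_mul (stableLength e g * _), ← h]
    refine le_csInf_mul (nonempty_distortionSet hδ hd he)
      (mul_nonneg (stableLength_nonneg he.2.1 g) (stableLength_nonneg hd.2.1 g')) fun r hr => ?_
    obtain ⟨l₁, l₂, h₁, h₂, rfl, h, h'⟩ := mem_distortionSet_iff.1 hr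
    have := mul_le_mul (h'.stableLength_le hd he g) (h.stableLength_le he hd g')
      (stableLength_nonneg he.2.1 g') (mul_nonneg h₂.le (stableLength_nonneg he.2.1 g))
    linarith
  set k := stableLength d a / stableLength e a with hk
  have hkpos : 0 < k := div_pos hda hea
  obtain ⟨A, hA, hA'⟩ := exists_le_mul_add_of_stableLength_le hδ hne hd he hkpos.le fun g => by
    have := key g a
    rw [hk, div_mul_eq_mul_div, le_div_iff₀ hea]
    linarith
  obtain ⟨B, hB, hB'⟩ := exists_le_mul_add_of_stableLength_le hδ hne he hd
    (inv_pos.2 hkpos).le fun g => by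
    have := key a g
    rw [hk, inv_div, div_mul_eq_mul_div, le_div_iff₀ hda]
    linarith
  refine ⟨k, A + k * B + 1, hkpos, by positivity, fun x y => abs_le.2 ⟨?_, ?_⟩⟩
  · have := mul_le_mul_of_nonneg_left (hB' x y) hkpos.le
    rw [mul_add, mul_inv_cancel_left₀ hkpos.ne'] at this
    linarith
  · have := hA' x y
    have : 0 ≤ k * B := by positivity
    linarith

/-! ### The metric on the space of metric structures -/

/-- The metric structure represented by a hyperbolic pseudometric. -/
def metricStructure (d : PseudoMetric G ℝ) (hd : d ∈ hypPseudometrics G) : MetricStructures G :=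
  Quotient.mk (roughSimilarity G) ⟨d, hd⟩

theorem exists_metricStructure_eq (ρ : MetricStructures G) :
    ∃ d, ∃ hd : d ∈ hypPseudometrics G, metricStructure d hd = ρ := by
  induction ρ using Quotient.inductionOn with
  | h d => exact ⟨d.1, d.2, rfl⟩

theorem metricStructure_eq_iff {d e : PseudoMetric G ℝ} {hd : d ∈ hypPseudometrics G}
    {he : e ∈ hypPseudometrics G} :
    metricStructure d hd = metricStructure e he ↔ AreRoughlySimilar d e :=
  Quotient.eq (r := roughSimilarity G)

theorem Lam_metricStructure {d e : PseudoMetric G ℝ} (hd : d ∈ hypPseudometrics G)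
    (he : e ∈ hypPseudometrics G) :
    Lam (metricStructure d hd) (metricStructure e he) = sInf (distortionSet d e) := rfl

theorem Lam_le_of_mem {d e : PseudoMetric G ℝ} (hd : d ∈ hypPseudometrics G)
    (he : e ∈ hypPseudometrics G) {r : ℝ} (hr : r ∈ distortionSet d e) :
    Lam (metricStructure d hd) (metricStructure e he) ≤ r :=
  csInf_le (bddBelow_distortionSet d e) hr

theorem one_le_Lam (hδ : HyperbolicWith (wordMetric hS) δ) (hne : ¬ IsVirtuallyAbelian G)
    (ρ σ : MetricStructures G) : 1 ≤ Lam ρ σ := by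
  obtain ⟨d, hd, rfl⟩ := exists_metricStructure_eq ρ
  obtain ⟨e, he, rfl⟩ := exists_metricStructure_eq σ
  exact le_csInf (nonempty_distortionSet hδ hd he) fun r hr =>
    one_le_of_mem_distortionSet hδ hne hd he hr

theorem Lam_self (hδ : HyperbolicWith (wordMetric hS) δ) (hne : ¬ IsVirtuallyAbelian G)
    (ρ : MetricStructures G) : Lam ρ ρ = 1 := by
  refine le_antisymm ?_ (one_le_Lam hδ hne ρ ρ)
  obtain ⟨d, hd, rfl⟩ := exists_metricStructure_eq ρ
  exact Lam_le_of_mem hd hd (one_mem_distortionSet d)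

theorem Lam_comm (ρ σ : MetricStructures G) : Lam ρ σ = Lam σ ρ := by
  obtain ⟨d, hd, rfl⟩ := exists_metricStructure_eq ρ
  obtain ⟨e, he, rfl⟩ := exists_metricStructure_eq σ
  rw [Lam_metricStructure, Lam_metricStructure, distortionSet_comm]

theorem Lam_le_mul (hδ : HyperbolicWith (wordMetric hS) δ) (hne : ¬ IsVirtuallyAbelian G)
    (ρ σ τ : MetricStructures G) : Lam ρ τ ≤ Lam ρ σ * Lam σ τ := by
  have h0 := one_le_Lam hδ hne σ τ
  obtain ⟨d, hd, rfl⟩ := exists_metricStructure_eq ρ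
  obtain ⟨e, he, rfl⟩ := exists_metricStructure_eq σ
  obtain ⟨f, hf, rfl⟩ := exists_metricStructure_eq τ
  refine le_csInf_mul (nonempty_distortionSet hδ hd he) (by linarith) fun r hr => ?_
  rw [mul_comm]
  refine le_csInf_mul (nonempty_distortionSet hδ he hf)
    (by linarith [one_le_of_mem_distortionSet hδ hne hd he hr]) fun q hq => ?_
  rw [mul_comm]
  exact Lam_le_of_mem hd hf (mul_mem_distortionSet hr hq)

theorem eq_of_Lam_eq_one (hδ : HyperbolicWith (wordMetric hS) δ) (hne : ¬ IsVirtuallyAbelian G)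
    {ρ σ : MetricStructures G} (h : Lam ρ σ = 1) : ρ = σ := by
  obtain ⟨d, hd, rfl⟩ := exists_metricStructure_eq ρ
  obtain ⟨e, he, rfl⟩ := exists_metricStructure_eq σ
  exact metricStructure_eq_iff.2 (areRoughlySimilar_of_sInf_distortionSet hδ hne hd he h)

/-- The metric `Δ` on the space of metric structures. -/
@[reducible]
def metricSpaceMetricStructures (hδ : HyperbolicWith (wordMetric hS) δ)
    (hne : ¬ IsVirtuallyAbelian G) : MetricSpace (MetricStructures G) where
  dist := Delta
  dist_self ρ := by simp [Delta, Lam_self hδ hne]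
  dist_comm ρ σ := by simp [Delta, Lam_comm ρ σ]
  dist_triangle ρ σ τ := by
    have h1 := one_le_Lam hδ hne ρ σ
    have h2 := one_le_Lam hδ hne σ τ
    have h3 := one_le_Lam hδ hne ρ τ
    simp only [Delta]
    rw [← Real.log_mul (by positivity) (by positivity)]
    exact Real.log_le_log (by positivity) (Lam_le_mul hδ hne ρ σ τ)
  eq_of_dist_eq_zero {ρ σ} h := by
    have h1 := one_le_Lam hδ hne ρ σ
    refine eq_of_Lam_eq_one hδ hne ?_
    exact Real.eq_one_of_pos_of_log_eq_zero (by positivity) h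

theorem exists_mem_distortionSet_lt (hδ : HyperbolicWith (wordMetric hS) δ)
    (hne : ¬ IsVirtuallyAbelian G) {d e : PseudoMetric G ℝ} (hd : d ∈ hypPseudometrics G)
    (he : e ∈ hypPseudometrics G) {x : ℝ}
    (hx : Delta (metricStructure d hd) (metricStructure e he) < x) :
    ∃ r ∈ distortionSet d e, r < Real.exp x := by
  have h1 := one_le_Lam hδ hne (metricStructure d hd) (metricStructure e he)
  exact exists_lt_of_csInf_lt (nonempty_distortionSet hδ hd he)
    ((Real.log_lt_iff_lt_exp (by positivity)).1 hx)

/-! ### Unboundedness -/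

theorem IsFiniteSymmGenSet.union_pair (hS : IsFiniteSymmGenSet S) (x : G) :
    IsFiniteSymmGenSet (S ∪ {x, x⁻¹}) where
  finite := hS.finite.union (by simp)
  symm := by
    rintro s (hs | hs | hs)
    · exact Or.inl (hS.symm s hs)
    · rw [hs]; simp
    · rw [Set.mem_singleton_iff.1 hs]; simp
  generates := top_le_iff.1 (hS.generates ▸ Subgroup.closure_mono Set.subset_union_left)

theorem mul_stableLength_le_stableLength_pow {d : PseudoMetric G ℝ} {n : ℕ} (hn : 0 < n) (g : G) :
    n * stableLength d g ≤ stableLength d (g ^ n) := by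
  refine le_csInf ⟨_, 1, Set.mem_Ici.2 le_rfl, rfl⟩ ?_
  rintro _ ⟨m, hm, rfl⟩
  have hm' : 0 < m := hm
  have h : stableLength d g ≤ d 1 (g ^ (n * m)) / (n * m : ℕ) :=
    csInf_le ⟨0, by
      rintro _ ⟨n, -, rfl⟩
      exact div_nonneg (d.nonneg _ _) (Nat.cast_nonneg n)⟩ ⟨n * m, Nat.mul_pos hn hm', rfl⟩
  have hn0 : (0 : ℝ) < n := by exact_mod_cast hn
  have hm0 : (0 : ℝ) < m := by exact_mod_cast hm'
  rw [Nat.cast_mul, le_div_iff₀ (by positivity)] at h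
  simp only
  rw [← pow_mul, le_div_iff₀ hm0]
  linarith

/-- Adding a large power `aⁿ` to the generators makes the length of `a` of order `1 / n`. If the
distortion stayed bounded, all lengths would be of order `1 / n`, and as the number of generators is
bounded, the growth rate of the original word metric would be arbitrarily small. -/
theorem exists_lt_Delta (hδ : HyperbolicWith (wordMetric hS) δ) (hne : ¬ IsVirtuallyAbelian G)
    (K : ℝ) : ∃ ρ σ : MetricStructures G, K < Delta ρ σ := by
  by_contra! hcon
  obtain ⟨a, ha⟩ := exists_stableLength_pos hδ hne
  obtain ⟨M, hM, hgrowth⟩ := exists_two_pow_le_card hδ hne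
  have hs := wordMetric_mem_hypPseudometrics hδ hS
  set ℓ := stableLength (wordMetric hS) a with hℓ
  have hℓ0 : 0 < ℓ := ha _ hs
  set q : ℝ := S.ncard + 3 with hq
  have hq1 : 1 ≤ q := by have : (0 : ℝ) ≤ S.ncard := Nat.cast_nonneg _; linarith
  have hlogq : 0 ≤ Real.log q := Real.log_nonneg hq1
  have main : ∀ n : ℕ, 0 < n → Real.log 2 * (n * ℓ) ≤ Real.exp (K + 1) * M * Real.log q := by
    intro n hn
    set hSn := hS.union_pair (a ^ n)
    have hd := wordMetric_mem_hypPseudometrics hδ hSn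
    obtain ⟨r, hr, hrK⟩ := exists_mem_distortionSet_lt hδ hne hs hd
      (lt_of_le_of_lt (hcon _ _) (lt_add_one K))
    obtain ⟨l₁, l₂, h₁, h₂, rfl, h, h'⟩ := mem_distortionSet_iff.1 hr
    have hl₂ : n * ℓ ≤ l₂ := by
      have e1 := h'.stableLength_le hs hd (a ^ n)
      have e2 : wordMetric hSn 1 (a ^ n) ≤ 1 := by
        rw [wordMetric_one]
        have := wordLength_prod_le (S := S ∪ {a ^ n, (a ^ n)⁻¹}) (l := [a ^ n]) (by simp)
        rw [List.prod_singleton] at this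
        exact_mod_cast this
      have e3 := stableLength_le (d := wordMetric hSn) (a ^ n)
      have e4 := mul_stableLength_le_stableLength_pow (d := wordMetric hS) hn a
      have e5 := mul_le_mul_of_nonneg_left (e3.trans e2) h₂.le
      linarith
    have hcard : ((S ∪ {a ^ n, (a ^ n)⁻¹}).ncard : ℝ) + 1 ≤ q := by
      have e1 := Set.ncard_union_le S {a ^ n, (a ^ n)⁻¹}
      have e2 := Set.ncard_insert_le (a ^ n) {(a ^ n)⁻¹}
      rw [Set.ncard_singleton] at e2
      have : (S ∪ {a ^ n, (a ^ n)⁻¹}).ncard ≤ S.ncard + 2 := by omega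
      have : ((S ∪ {a ^ n, (a ^ n)⁻¹}).ncard : ℝ) ≤ S.ncard + 2 := by exact_mod_cast this
      linarith
    obtain ⟨A, hA, hA'⟩ := h
    classical
    obtain ⟨T, hT, hT1, hTpow⟩ := hSn.exists_finset_pow
    have hTq : (T.card : ℝ) ≤ q := le_trans (by exact_mod_cast hT) hcard
    have hgr : ∀ k : ℕ, k * Real.log 2 ≤ (l₁ * (k * M) + A) * Real.log q := by
      intro k
      set j := ⌊l₁ * (k * M) + A⌋₊ with hj
      have hjle : (j : ℝ) ≤ l₁ * (k * M) + A := Nat.floor_le (by positivity)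
      have hpow := hgrowth k (T ^ j) fun g hg => hTpow j g (by
        have e1 := hA' 1 g
        rw [wordMetric_one] at e1
        exact Nat.le_floor (e1.trans (by
          have := mul_le_mul_of_nonneg_left hg h₁.le
          linarith)))
      have e1 : (2 : ℝ) ^ k ≤ q ^ j := by
        calc (2 : ℝ) ^ k ≤ ((T ^ j).card : ℝ) := by exact_mod_cast hpow
          _ ≤ (T.card : ℝ) ^ j := by exact_mod_cast Finset.card_pow_le
          _ ≤ q ^ j := by gcongr
      have e2 := Real.log_le_log (by positivity) e1
      rw [Real.log_pow, Real.log_pow] at e2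
      exact e2.trans (mul_le_mul_of_nonneg_right hjle hlogq)
    have hrate : Real.log 2 ≤ l₁ * M * Real.log q := by
      by_contra! hlt
      obtain ⟨k, hk⟩ := exists_nat_gt (A * Real.log q / (Real.log 2 - l₁ * M * Real.log q))
      rw [div_lt_iff₀ (by linarith)] at hk
      have := hgr k
      linarith
    have e1 : l₁ * (n * ℓ) ≤ Real.exp (K + 1) :=
      (mul_le_mul_of_nonneg_left hl₂ h₁.le).trans hrK.le
    have e2 : 0 ≤ n * ℓ := by positivity
    have e3 : 0 ≤ M * Real.log q := by positivity
    calc Real.log 2 * (n * ℓ) ≤ (l₁ * M * Real.log q) * (n * ℓ) :=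
          mul_le_mul_of_nonneg_right hrate e2
      _ = l₁ * (n * ℓ) * (M * Real.log q) := by ring
      _ ≤ Real.exp (K + 1) * (M * Real.log q) := mul_le_mul_of_nonneg_right e1 e3
      _ = _ := by ring
  have hlog2 : 0 < Real.log 2 := Real.log_pos (by norm_num)
  obtain ⟨n, hn⟩ := exists_nat_gt (Real.exp (K + 1) * M * Real.log q / (Real.log 2 * ℓ))
  have hn0 : 0 < n := by
    have : (0 : ℝ) < n := lt_of_le_of_lt (by positivity) hn
    exact_mod_cast this
  rw [div_lt_iff₀ (by positivity)] at hn
  have := main n hn0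
  linarith

end Distortion

/-! ### Weighted sums and contractibility -/

section Contractible

variable {G : Type*} [Group G] {S : Set G} {hS : IsFiniteSymmGenSet S} {δ : ℝ}

/-- The pseudometric `α * d + β * e`. -/
def weightedSum {X : Type*} (d e : PseudoMetric X ℝ) {α β : ℝ} (hα : 0 ≤ α) (hβ : 0 ≤ β) :
    PseudoMetric X ℝ where
  toFun x y := α * d x y + β * e x y
  refl' x := by simp
  symm' x y := by rw [d.symm, e.symm]
  triangle' x y z := by
    have h1 := mul_le_mul_of_nonneg_left (d.triangle x y z) hα
    have h2 := mul_le_mul_of_nonneg_left (e.triangle x y z) hβ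
    linarith

theorem weightedSum_mem (hδ : HyperbolicWith (wordMetric hS) δ) {d e : PseudoMetric G ℝ}
    (hd : d ∈ hypPseudometrics G) (he : e ∈ hypPseudometrics G) {α β : ℝ} (hα : 0 ≤ α)
    (hβ : 0 ≤ β) (hαβ : 0 < α + β) : weightedSum d e hα hβ ∈ hypPseudometrics G := by
  obtain ⟨hinv, ⟨L, ε, hL, hε, h⟩, hP⟩ := (mem_hypPseudometrics_iff hδ d).1 hd
  obtain ⟨hinv', ⟨L', ε', hL', hε', h'⟩, hP'⟩ := (mem_hypPseudometrics_iff hδ e).1 he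
  refine (mem_hypPseudometrics_iff hδ _).2 ⟨fun g x y => ?_, ?_, hP.add hP' hα hβ⟩
  · change α * d (g * x) (g * y) + β * e (g * x) (g * y) = α * d x y + β * e x y
    rw [hinv, hinv']
  · refine ⟨(α * L + β * L') + (L + L') / (α + β),
      (α * ε + β * ε') + (α * ε + β * ε') / (α + β), by positivity, by positivity,
      fun x y => ?_⟩
    change α * d x y + β * e x y ≤ _ ∧ _ ≤ _ * (α * d x y + β * e x y) + _
    obtain ⟨h1, h2⟩ := h x y
    obtain ⟨h3, h4⟩ := h' x y
    have a1 := mul_le_mul_of_nonneg_left h1 hα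
    have a2 := mul_le_mul_of_nonneg_left h2 hα
    have a3 := mul_le_mul_of_nonneg_left h3 hβ
    have a4 := mul_le_mul_of_nonneg_left h4 hβ
    have s0 := (wordMetric hS).nonneg x y
    have d0 := d.nonneg x y
    have e0 := e.nonneg x y
    have p1 : 0 ≤ (L + L') / (α + β) * wordMetric hS x y := by positivity
    have p2 : 0 ≤ (α * ε + β * ε') / (α + β) := by positivity
    have p3 : 0 ≤ (α * L + β * L') * (α * d x y + β * e x y) := by positivity
    have p4 : 0 ≤ α * ε + β * ε' := by positivity
    constructor
    · linarith
    · have b1 : 0 ≤ α * L' * d x y := by positivity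
      have b2 : 0 ≤ β * L * e x y := by positivity
      have b3 : wordMetric hS x y ≤
          ((L + L') * (α * d x y + β * e x y) + (α * ε + β * ε')) / (α + β) := by
        rw [le_div_iff₀ hαβ]
        linarith
      rw [add_div, mul_div_right_comm] at b3
      linarith

/-- After normalization at an element of positive stable length, the two domination constants are
both bounded by the distortion. -/
theorem exists_normalized_le {d e : PseudoMetric G ℝ} (hd : d ∈ hypPseudometrics G)
    (he : e ∈ hypPseudometrics G) {a : G} (hda : 0 < stableLength d a)
    (hea : 0 < stableLength e a) {r : ℝ} (hr : r ∈ distortionSet d e) :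
    ∃ A : ℝ, 0 ≤ A ∧ ∀ x y,
      d x y / stableLength d a ≤ r * (e x y / stableLength e a) + A ∧
      e x y / stableLength e a ≤ r * (d x y / stableLength d a) + A := by
  have aux : ∀ {d e : PseudoMetric G ℝ}, d ∈ hypPseudometrics G → e ∈ hypPseudometrics G →
      0 < stableLength d a → 0 < stableLength e a → ∀ {l₁ l₂ : ℝ}, 0 < l₁ → 0 < l₂ →
      CoarselyLE e d l₁ → CoarselyLE d e l₂ → ∃ A : ℝ, 0 ≤ A ∧ ∀ x y,
        d x y / stableLength d a ≤ l₁ * l₂ * (e x y / stableLength e a) + A := by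
    intro d e hd he hda hea l₁ l₂ h₁ h₂ h h'
    have hle := h.stableLength_le he hd a
    obtain ⟨A, hA, hA'⟩ := h'
    refine ⟨A / stableLength d a, by positivity, fun x y => ?_⟩
    have h1 : d x y / stableLength d a ≤ (l₂ * e x y + A) / stableLength d a :=
      div_le_div_of_nonneg_right (hA' x y) hda.le
    have h2 : 1 / stableLength d a ≤ l₁ / stableLength e a := by
      rw [div_le_div_iff₀ hda hea]; linarith
    have h3 := mul_le_mul_of_nonneg_left h2 (mul_nonneg h₂.le (e.nonneg x y))
    calc d x y / stableLength d a ≤ l₂ * e x y * (1 / stableLength d a) + A / stableLength d a := by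
          rw [mul_one_div, ← add_div]; exact h1
      _ ≤ l₂ * e x y * (l₁ / stableLength e a) + A / stableLength d a := by linarith
      _ = _ := by ring
  obtain ⟨l₁, l₂, h₁, h₂, rfl, h, h'⟩ := mem_distortionSet_iff.1 hr
  obtain ⟨A, hA, hA'⟩ := aux hd he hda hea h₁ h₂ h h'
  obtain ⟨B, hB, hB'⟩ := aux he hd hea hda h₂ h₁ h' h
  refine ⟨A + B, by positivity, fun x y => ⟨by linarith [hA' x y], ?_⟩⟩
  have := hB' x y
  rw [mul_comm l₂ l₁] at this
  linarith

/-- The straight line homotopy between normalized pseudometrics varies continuously: changing the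
starting point changes it by at most the distortion, and changing the time from `t` to `s` changes
it by a factor close to one. -/
theorem mem_distortionSet_blend {X : Type*} {N N' M E E' : X → X → ℝ} {r K A B t s : ℝ}
    (hr : 1 ≤ r) (hA : 0 ≤ A) (hB : 0 ≤ B) (ht : t ∈ Set.Icc (0 : ℝ) 1)
    (hs : s ∈ Set.Icc (0 : ℝ) 1) (hM0 : ∀ x y, 0 ≤ M x y) (hN0 : ∀ x y, 0 ≤ N x y)
    (hK0 : 0 ≤ K) (hη : |t - s| * (K + 1) < 1)
    (hN : ∀ x y, N x y ≤ r * N' x y + A ∧ N' x y ≤ r * N x y + A)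
    (hM : ∀ x y, N x y ≤ K * M x y + B ∧ M x y ≤ K * N x y + B)
    (hE : ∀ x y, E x y = (1 - t) * N x y + t * M x y)
    (hE' : ∀ x y, E' x y = (1 - s) * N' x y + s * M x y) :
    r ^ 2 * ((1 + |t - s| * (K + 1)) / (1 - |t - s| * (K + 1))) ∈ distortionSet E E' := by
  obtain ⟨ht0, ht1⟩ := ht
  obtain ⟨hs0, hs1⟩ := hs
  set η := |t - s| * (K + 1) with hηdef
  have hη0 : 0 ≤ η := by positivity
  have hts : |t - s| ≤ 1 := abs_le.2 ⟨by linarith, by linarith⟩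
  have hr0 : 0 < r := by linarith
  -- `P` has the time of `E'` and the starting point of `E`
  set P : X → X → ℝ := fun x y => (1 - s) * N x y + s * M x y with hP
  have hPE' : ∀ x y, P x y ≤ r * E' x y + A ∧ E' x y ≤ r * P x y + A := by
    intro x y
    obtain ⟨h1, h2⟩ := hN x y
    have a1 := mul_le_mul_of_nonneg_left h1 (sub_nonneg.2 hs1)
    have a2 := mul_le_mul_of_nonneg_left h2 (sub_nonneg.2 hs1)
    have a3 := mul_le_mul_of_nonneg_right hr (mul_nonneg hs0 (hM0 x y))
    have a4 : (1 - s) * A ≤ A := by nlinarith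
    simp only [hP, hE']
    constructor <;> linarith
  have hPE : ∀ x y, |P x y - E x y| ≤ η * E x y + B := by
    intro x y
    obtain ⟨h1, h2⟩ := hM x y
    have e1 : P x y - E x y = (t - s) * (N x y - M x y) := by
      simp only [hP, hE]; ring
    have e2 : |N x y - M x y| ≤ (K + 1) * E x y + B := by
      have a1 := mul_le_mul_of_nonneg_left
        (show N x y + M x y ≤ (K + 1) * N x y + B by linarith) (sub_nonneg.2 ht1)
      have a2 := mul_le_mul_of_nonneg_left
        (show N x y + M x y ≤ (K + 1) * M x y + B by linarith) ht0
      have a3 : N x y + M x y ≤ (K + 1) * E x y + B := by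
        rw [hE]; linarith
      have := hN0 x y
      have := hM0 x y
      exact abs_le.2 ⟨by linarith, by linarith⟩
    rw [e1, abs_mul]
    have a4 := mul_le_mul_of_nonneg_left e2 (abs_nonneg (t - s))
    have a5 := mul_le_mul_of_nonneg_right hts hB
    rw [hηdef]
    linarith
  have h1η : 0 < 1 - η := by linarith
  refine mem_distortionSet_iff.2 ⟨r * (1 + η), r / (1 - η), by positivity, by positivity, ?_,
    ⟨r * B + A, by positivity, fun x y => ?_⟩,
    ⟨(A + B) / (1 - η), by positivity, fun x y => ?_⟩⟩
  · field_simp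
  · have h1 := (abs_le.1 (hPE x y)).2
    have h2 := mul_le_mul_of_nonneg_left h1 hr0.le
    have h3 := (hPE' x y).2
    linarith
  · have h1 := (abs_le.1 (hPE x y)).1
    have h3 := (hPE' x y).1
    rw [div_mul_eq_mul_div, ← add_div, le_div_iff₀ h1η]
    linarith

/-- Representatives normalized to have stable length one at `a` are moved along straight lines to
the normalized word metric. -/
theorem contractibleSpace_metricStructures (hδ : HyperbolicWith (wordMetric hS) δ)
    (hne : ¬ IsVirtuallyAbelian G) :
    letI := metricSpaceMetricStructures hδ hne
    ContractibleSpace (MetricStructures G) := by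
  let _ := metricSpaceMetricStructures hδ hne
  obtain ⟨a, ha⟩ := exists_stableLength_pos hδ hne
  have hs := wordMetric_mem_hypPseudometrics hδ hS
  have hsa := ha _ hs
  choose D hD hDeq using exists_metricStructure_eq (G := G)
  have hDa : ∀ ρ, 0 < stableLength (D ρ) a := fun ρ => ha _ (hD ρ)
  have hnn : ∀ (t : unitInterval) (ρ : MetricStructures G),
      0 ≤ (1 - (t : ℝ)) / stableLength (D ρ) a ∧
      0 ≤ (t : ℝ) / stableLength (wordMetric hS) a := fun t ρ =>
    ⟨div_nonneg (sub_nonneg.2 t.2.2) (hDa ρ).le, div_nonneg t.2.1 hsa.le⟩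
  have hpos : ∀ (t : unitInterval) (ρ : MetricStructures G),
      0 < (1 - (t : ℝ)) / stableLength (D ρ) a + (t : ℝ) / stableLength (wordMetric hS) a := by
    intro t ρ
    rcases t.2.1.eq_or_lt with h | h
    · rw [← h]
      have := hDa ρ
      positivity
    · exact add_pos_of_nonneg_of_pos (hnn t ρ).1 (div_pos h hsa)
  set F : unitInterval × MetricStructures G → MetricStructures G := fun p =>
    metricStructure (weightedSum (D p.2) (wordMetric hS) (hnn p.1 p.2).1 (hnn p.1 p.2).2)
      (weightedSum_mem hδ (hD p.2) hs (hnn p.1 p.2).1 (hnn p.1 p.2).2 (hpos p.1 p.2)) with hF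
  have hcont : Continuous F := by
    refine continuous_iff_continuousAt.2 fun ⟨t, ρ⟩ => ?_
    obtain ⟨K, hK⟩ := nonempty_distortionSet hδ (hD ρ) hs
    have hK1 := one_le_of_mem_distortionSet hδ hne (hD ρ) hs hK
    obtain ⟨B, hB, hB'⟩ := exists_normalized_le (hD ρ) hs (hDa ρ) hsa hK
    have hbound : ∀ (s : unitInterval) (σ : MetricStructures G),
        |(t : ℝ) - s| * (K + 1) < 1 → dist (F (t, ρ)) (F (s, σ)) ≤ 2 * dist ρ σ +
          Real.log ((1 + |(t : ℝ) - s| * (K + 1)) / (1 - |(t : ℝ) - s| * (K + 1))) := by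
      intro s σ hη
      rw [← sub_le_iff_le_add, ← div_le_iff₀' (by norm_num : (0 : ℝ) < 2)]
      refine le_of_forall_gt fun x hx => ?_
      have hx' : Delta (metricStructure (D ρ) (hD ρ)) (metricStructure (D σ) (hD σ)) < x := by
        rw [hDeq, hDeq]; exact hx
      obtain ⟨r, hr, hrx⟩ := exists_mem_distortionSet_lt hδ hne (hD ρ) (hD σ) hx'
      have hr1 := one_le_of_mem_distortionSet hδ hne (hD ρ) (hD σ) hr
      obtain ⟨A, hA, hA'⟩ := exists_normalized_le (hD ρ) (hD σ) (hDa ρ) (hDa σ) hr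
      have hmem := mem_distortionSet_blend hr1 hA hB t.2 s.2
        (fun x y => div_nonneg ((wordMetric hS).nonneg x y) hsa.le)
        (fun x y => div_nonneg ((D ρ).nonneg x y) (hDa ρ).le) (by linarith) hη hA' hB'
        (E := weightedSum (D ρ) (wordMetric hS) (hnn t ρ).1 (hnn t ρ).2)
        (E' := weightedSum (D σ) (wordMetric hS) (hnn s σ).1 (hnn s σ).2)
        (fun x y => by
          change (1 - (t : ℝ)) / stableLength (D ρ) a * D ρ x y +
            (t : ℝ) / stableLength (wordMetric hS) a * wordMetric hS x y = _
          ring)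
        (fun x y => by
          change (1 - (s : ℝ)) / stableLength (D σ) a * D σ x y +
            (s : ℝ) / stableLength (wordMetric hS) a * wordMetric hS x y = _
          ring)
      have hle := Lam_le_of_mem
        (weightedSum_mem hδ (hD ρ) hs (hnn t ρ).1 (hnn t ρ).2 (hpos t ρ))
        (weightedSum_mem hδ (hD σ) hs (hnn s σ).1 (hnn s σ).2 (hpos s σ)) hmem
      have hη0 : 0 ≤ |(t : ℝ) - s| * (K + 1) := by positivity
      have hlog := Real.log_le_log
        (lt_of_lt_of_le one_pos (one_le_Lam hδ hne (F (t, ρ)) (F (s, σ)))) hle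
      have hq : 0 < (1 + |(t : ℝ) - s| * (K + 1)) / (1 - |(t : ℝ) - s| * (K + 1)) :=
        div_pos (by linarith) (by linarith)
      rw [Real.log_mul (by positivity) hq.ne', Real.log_pow] at hlog
      have hrx' : Real.log r < x := (Real.log_lt_iff_lt_exp (by linarith)).2 hrx
      have hdist : dist (F (t, ρ)) (F (s, σ)) = Real.log (Lam (F (t, ρ)) (F (s, σ))) := rfl
      rw [div_lt_iff₀' (by norm_num : (0 : ℝ) < 2), hdist]
      push_cast at hlog
      linarith
    rw [ContinuousAt, tendsto_iff_dist_tendsto_zero]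
    have hη : Filter.Tendsto (fun p : unitInterval × MetricStructures G =>
        |(t : ℝ) - p.1| * (K + 1)) (nhds (t, ρ)) (nhds 0) := by
      have : Continuous fun p : unitInterval × MetricStructures G =>
          |(t : ℝ) - p.1| * (K + 1) := by fun_prop
      simpa using this.tendsto (t, ρ)
    have hd : Filter.Tendsto (fun p : unitInterval × MetricStructures G => dist ρ p.2)
        (nhds (t, ρ)) (nhds 0) := by
      have : Continuous fun p : unitInterval × MetricStructures G => dist ρ p.2 := by fun_prop
      simpa using this.tendsto (t, ρ)
    have hlim : Filter.Tendsto (fun p : unitInterval × MetricStructures G => 2 * dist ρ p.2 +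
        Real.log ((1 + |(t : ℝ) - p.1| * (K + 1)) / (1 - |(t : ℝ) - p.1| * (K + 1))))
        (nhds (t, ρ)) (nhds 0) := by
      have h1 : Filter.Tendsto (fun p : unitInterval × MetricStructures G =>
          (1 + |(t : ℝ) - p.1| * (K + 1)) / (1 - |(t : ℝ) - p.1| * (K + 1)))
          (nhds (t, ρ)) (nhds ((1 + 0) / (1 - 0))) :=
        (hη.const_add 1).div (hη.const_sub 1) (by norm_num)
      have h2 := (hd.const_mul 2).add (h1.log (by norm_num))
      simpa using h2
    refine squeeze_zero' (Filter.Eventually.of_forall fun _ => dist_nonneg) ?_ hlim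
    filter_upwards [hη.eventually_lt_const one_pos] with p hp
    rw [dist_comm]
    exact hbound p.1 p.2 hp
  rw [contractible_iff_id_nullhomotopic]
  refine ⟨metricStructure _ hs, ⟨⟨⟨F, hcont⟩, fun ρ => ?_, fun ρ => ?_⟩⟩⟩
  · refine Eq.trans (metricStructure_eq_iff.2 ?_) (hDeq ρ)
    refine ⟨1 / stableLength (D ρ) a, 1, one_div_pos.2 (hDa ρ), one_pos, fun x y => ?_⟩
    change |(1 - 0) / _ * D ρ x y + 0 / _ * _ - _| ≤ _
    simp
  · refine metricStructure_eq_iff.2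
      ⟨1 / stableLength (wordMetric hS) a, 1, one_div_pos.2 hsa, one_pos, fun x y => ?_⟩
    change |(1 - 1) / _ * _ + 1 / _ * wordMetric hS x y - _| ≤ _
    simp

end Contractible

end HypMetric

end

theorem theorem1p1 {G : Type*} [Group G] (hG : HypMetric.IsHyperbolicGroup G)
    (hne : ¬ HypMetric.IsVirtuallyAbelian G) :
    ∃ m : MetricSpace (HypMetric.MetricStructures G),
      (∀ ρ₁ ρ₂ : HypMetric.MetricStructures G, m.dist ρ₁ ρ₂ = HypMetric.Delta ρ₁ ρ₂) ∧
      ¬ Bornology.IsBounded (Set.univ : Set (HypMetric.MetricStructures G)) ∧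
      ContractibleSpace (HypMetric.MetricStructures G) := by
  obtain ⟨S, hS, δ, hδ⟩ := hG
  have hδ' : HypMetric.HyperbolicWith (HypMetric.wordMetric hS) δ := hδ
  refine ⟨HypMetric.metricSpaceMetricStructures hδ' hne, fun _ _ => rfl, fun hb => ?_,
    HypMetric.contractibleSpace_metricStructures hδ' hne⟩
  let _ := HypMetric.metricSpaceMetricStructures hδ' hne
  obtain ⟨K, hK⟩ := Metric.isBounded_iff.1 hb
  obtain ⟨ρ, σ, h⟩ := HypMetric.exists_lt_Delta hδ' hne K
  exact absurd (hK (Set.mem_univ ρ) (Set.mem_univ σ)) (not_le.2 h)
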